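/- \textbf{Setting.} Let $Q=[-1,1]^2$, $P_X$ the uniform distribution on $Q$, $\sigma>0$, and let $(X_i,Y_i)_{i\le n}$ be i.i.d. with $X_i\sim P_X$ and $Y_i=f^*(X_i)+\xi_i$, where $\xi_i\sim N(0,\sigma^2)$ is independent of $X_i$. \textit{Function class.} For $\beta,F>0$ let $H^\beta_F([-1,1]^d)$ be the set of functions on $[-1,1]^d$ with sup norm at most $F$ whose partial derivatives up to order $\lfloor\beta\rfloor$ exist and are bounded, those of order $\lfloor\beta\rfloor$ being Hölder with exponent $\beta-\lfloor\beta\rfloor$. Given finitely many curves $h_1,\dots,h_J\in H^\alpha_F([-1,1])$ and indices $d_j\in\{1,2\}$, put $I_j^{+}=\{x\in Q: x_{d_j}\ge h_j(x_{-d_j})\}$ and $I_j^{-}=\{x\in Q: x_{d_j}\le h_j(x_{-d_j})\}$, where $x_{-d}$ is the other coordinate. For a partition $\mathcal T_1,\dots,\mathcal T_M$ of $\{+,-\}^J$ into nonempty sets let $R_m=\bigcup_{t\in\mathcal T_m}\bigcap_j I_j^{t_j}$. The class $\mathcal F^{PS}_{\alpha,\beta,M}$ consists of all $\sum_{m\le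 M} f_m 1_{R_m}$ with $f_m\in H_F^\beta(Q)$, over all $J$, curves and partitions. \textit{Curvelets.} Let $\omega$ be a bounded measurable function, not a.e. zero, with compact support in $(0,\infty)$; let $\nu$ be measurable, supported in $[-\pi,\pi]$, with $\nu(z)^2+\nu(z-\pi)^2=1$ for $z\in[0,\pi)$. For $j\ge1$ and $0\le\ell<2^j$ put $$\chi_{j,\ell}(\xi)=\omega(2^{-2j}|\xi|)\,\bigl(\nu_{j,\ell}(\theta(\xi))+\nu_{j,\ell}(\theta(\xi)+\pi)\bigr),\qquad \nu_{j,\ell}(z)=\nu(2^jz-\pi\ell),$$ where $\theta(\xi)$ is the polar angle, angles being taken modulo $2\pi$; for $j=0$, $\ell=0$ let $\chi_{0,0}$ be any bounded, even, measurable window (the coarsest scale). For $\delta_1,\delta_2>0$ and $k\in\mathbb Z^2$ let $$u_{j,k}(\xi)=\frac{2^{-3j/2}}{2\pi\sqrt{\delta_1\delta_2}}\;e^{i(k_1+1/2)2^{-2j}\xi_1/\delta_1}\;e^{ik_22^{-j}\xi_2/\delta_2},$$ and let $\gamma_{j,\ell,k}$ be the real function with Fourier transform $2\pi\,\chi_{j,\ell}(\xi)\,u_{j,k}(R^*_{j,\ell}\xi)$,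 with the convention $\gamma(x)=(2\pi)^{-2}\int e^{ix\cdot\xi}\hat\gamma(\xi)\,d\xi$, where $R^*_{j,\ell}$ is the rotation by the angle $-\pi\ell2^{-j}$. Assume that for all $j,\ell$ the image under $R^*_{j,\ell}$ of $\{\chi_{j,\ell}\ne0\}$ lies in the rectangle $|\xi_1|\le\pi\delta_12^{2j}$, $|\xi_2|\le\pi\delta_22^{j}$, on which $\{u_{j,k}\}_{k}$ is an orthonormal basis. \textit{Estimator.} Fix $\kappa>0$ and $j_0\in\{0,1\}$. For a truncation level $\tau\in\{0,1,2,\dots\}$ let $$\hat f_\tau^{\mathrm{curve}}=\sum_{j_0\le j\le\tau}\;\sum_{0\le\ell<2^j}\;\sum_{k\in\mathbb Z^2}\hat w_{j,\ell,k}\,\gamma_{j,\ell,k},\qquad \hat w_{j,\ell,k}=\frac{\kappa}{n}\sum_{i=1}^nY_i\gamma_{j,\ell,k}(X_i).$$ \textbf{Proposition (sub-optimality of curvelet estimators).} Let $\alpha,\beta\ge2$, $M\ge2$, $F>0$. There is a constant $c>0$, independent of $n$ and $\tau$, such that for all $n\ge1$ and all truncation levels $\tau$ (in particular those that minimize the risk)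 $$\sup_{f^*\in\mathcal F^{PS}_{\alpha,\beta,M}}\mathbb E_{f^*}\bigl[\|\hat f_\tau^{\mathrm{curve}}-f^*\|^2_{L^2(P_X)}\bigr]\ge c\,n^{-1/3}.$$ The bound is witnessed by the product of two step functions: for $f^*(x)=1_{\{x_1\ge0\}}1_{\{x_2\ge0\}}$ the risk is at least $c\,n^{-1/3}$ for all $n\ge1$ and all $\tau$, and $f^*\in\mathcal F^{PS}_{\alpha,\beta,M}$ whenever $F\ge1$. -/

import Mathlib

open MeasureTheory ProbabilityTheory

noncomputable section

/-- Euclidean space of dimension `d`. -/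
abbrev E (d : ℕ) : Type := EuclideanSpace ℝ (Fin d)

/-- The cube `[-1,1]^d`. -/
def cube (d : ℕ) : Set (E d) := {x | ∀ i, x i ∈ Set.Icc (-1 : ℝ) 1}

/-! ### Hölder functions and piecewise smooth functions on the cube -/

/-- `f` belongs to the Hölder space `H^β([-1,1]^d)`: with `k = ⌊β⌋`, there is a family `g a`
(`a` a multi-index) of partial derivatives `∂^a f`, `|a| ≤ k`, on the cube (one-sided at the
boundary), all of them bounded, those of order `k` being Hölder with exponent `β - k`. -/
def IsHolder (d : ℕ) (β : ℝ) (f : E d → ℝ) : Prop :=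
  ∃ g : (Fin d → ℕ) → E d → ℝ,
    (∀ x ∈ cube d, g 0 x = f x) ∧
    (∀ a : Fin d → ℕ, ∑ i, a i < ⌊β⌋₊ → ∀ i : Fin d, ∀ x ∈ cube d,
      HasDerivWithinAt (fun t : ℝ => g a (x + t • EuclideanSpace.single i (1 : ℝ)))
        (g (a + Pi.single i 1) x)
        {t : ℝ | x + t • EuclideanSpace.single i (1 : ℝ) ∈ cube d} 0) ∧
    ∃ C : ℝ,
      (∀ a : Fin d → ℕ, ∑ i, a i ≤ ⌊β⌋₊ → ∀ x ∈ cube d, |g a x| ≤ C) ∧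
      (∀ a : Fin d → ℕ, ∑ i, a i = ⌊β⌋₊ → ∀ x ∈ cube d, ∀ y ∈ cube d, x ≠ y →
        |g a x - g a y| ≤ C * ‖x - y‖ ^ (β - (⌊β⌋₊ : ℝ)))

/-- The set `H_F^β([-1,1]^d)` of Hölder functions bounded by `F` in sup norm. -/
def holderBall (d : ℕ) (β F : ℝ) : Set (E d → ℝ) :=
  {f | IsHolder d β f ∧ ∀ x ∈ cube d, |f x| ≤ F}

/-- The vector `x_{-i}`: the coordinate `i` of `x` is removed. -/
def dropCoord (i : Fin 2) (x : E 2) : E 1 := WithLp.toLp 2 (fun m => x (i.succAbove m))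

/-- One side of the curve `x_i = h(x_{-i})` in the square: `x_i ≥ h(x_{-i})` for `true` (the
sign `+`), `x_i ≤ h(x_{-i})` for `false` (the sign `-`). -/
def side (i : Fin 2) (h : E 1 → ℝ) (s : Bool) : Set (E 2) :=
  {x | x ∈ cube 2 ∧ if s then h (dropCoord i x) ≤ x i else x i ≤ h (dropCoord i x)}

/-- The piece `R_T = ⋃_{t ∈ T} ⋂_j I_j^{t_j}` of the square. -/
def piece {J : ℕ} (d : Fin J → Fin 2) (h : Fin J → E 1 → ℝ) (T : Set (Fin J → Bool)) :
    Set (E 2) :=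
  {x | x ∈ cube 2 ∧ ∃ t ∈ T, ∀ j, x ∈ side (d j) (h j) (t j)}

/-- The class of piecewise smooth functions on `[-1,1]^2` with `M` pieces: `∑_m f_m 1_{R_m}`
with `f_m ∈ H_F^β`, where the pieces come from finitely many curves in `H_F^α` and a partition
of the set of sign vectors into `M` parts. Only the values on the square matter. -/
def piecewiseSmooth (α β F : ℝ) (M : ℕ) : Set (E 2 → ℝ) :=
  {f | ∃ (J : ℕ) (d : Fin J → Fin 2) (h : Fin J → E 1 → ℝ) (T : Fin M → Set (Fin J → Bool))
      (fm : Fin M → E 2 → ℝ),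
    (∀ j, h j ∈ holderBall 1 α F) ∧
    (∀ m, (T m).Nonempty) ∧ (∀ t, ∃! m, t ∈ T m) ∧
    (∀ m, fm m ∈ holderBall 2 β F) ∧
    ∀ x ∈ cube 2, f x = ∑ m, (piece d h (T m)).indicator (fm m) x}

/-- The product of two step functions `1_{x₁ ≥ 0} 1_{x₂ ≥ 0}`. -/
def stepProduct (x : E 2) : ℝ := if 0 ≤ x 0 ∧ 0 ≤ x 1 then 1 else 0

/-! ### Curvelets -/

/-- The data from which curvelets are built: the radial window `ω`, the angular window `ν`, the
window `low` of the coarsest scale `j = 0` and the spacings `δ₁`, `δ₂`. -/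
structure CurveletSystem where
  ω : ℝ → ℝ
  ν : ℝ → ℝ
  low : E 2 → ℝ
  δ₁ : ℝ
  δ₂ : ℝ

namespace CurveletSystem

/-- The polar angle of `ξ`. -/
def polarAngle (ξ : E 2) : ℝ := Complex.arg ⟨ξ 0, ξ 1⟩

/-- The rotation angle `θ_{j,ℓ} = π ℓ 2^{-j}`. -/
def rotAngle (j ℓ : ℕ) : ℝ := Real.pi * ℓ / 2 ^ j

/-- `R_θ^* ξ`, the rotation of `ξ` by the angle `-θ`. -/
def rotStar (θ : ℝ) (ξ : E 2) : E 2 :=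
  !₂[Real.cos θ * ξ 0 + Real.sin θ * ξ 1, -Real.sin θ * ξ 0 + Real.cos θ * ξ 1]

variable (W : CurveletSystem)

/-- The angular window `ν_{j,ℓ}(z) = ν(2^j z - πℓ)`. -/
def angular (j ℓ : ℕ) (z : ℝ) : ℝ := W.ν (2 ^ j * z - Real.pi * ℓ)

/-- The frequency window `χ_{j,ℓ}(ξ) = ω(2^{-2j}|ξ|) (ν_{j,ℓ}(θ) + ν_{j,ℓ}(θ + π))`, where `θ` is
the polar angle of `ξ` and angles are understood modulo `2π`: one sums over all the
representatives `θ + m π`, and those with `|m| > 2` contribute `0` if `ℓ < 2^j` and `ν` is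
supported in `[-π, π]`. At the coarsest scale it is the window `low`. -/
def chi (j ℓ : ℕ) (ξ : E 2) : ℝ :=
  if j = 0 then W.low ξ
  else W.ω (‖ξ‖ / 2 ^ (2 * j)) *
    ∑ m ∈ Finset.Icc (-2 : ℤ) 2, W.angular j ℓ (polarAngle ξ + m * Real.pi)

/-- `u_{j,k}(ξ) = 2^{-3j/2} (2π √(δ₁δ₂))⁻¹ e^{i (k₁+1/2) 2^{-2j} ξ₁/δ₁} e^{i k₂ 2^{-j} ξ₂/δ₂}`. -/
def u (j : ℕ) (k : ℤ × ℤ) (ξ : E 2) : ℂ :=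
  (((2 : ℝ) ^ (-(3 * (j : ℝ) / 2)) / (2 * Real.pi * Real.sqrt (W.δ₁ * W.δ₂)) : ℝ) : ℂ) *
    Complex.exp (Complex.I *
      ((((k.1 : ℝ) + 1 / 2) * (ξ 0 / (2 ^ (2 * j) * W.δ₁)) : ℝ) : ℂ)) *
    Complex.exp (Complex.I * (((k.2 : ℝ) * (ξ 1 / (2 ^ j * W.δ₂)) : ℝ) : ℂ))

/-- The Fourier transform `2π χ_{j,ℓ}(ξ) u_{j,k}(R_θ^* ξ)` of the curvelet `γ_{j,ℓ,k}`. -/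
def curveletHat (j ℓ : ℕ) (k : ℤ × ℤ) (ξ : E 2) : ℂ :=
  ((2 * Real.pi * W.chi j ℓ ξ : ℝ) : ℂ) * W.u j k (rotStar (rotAngle j ℓ) ξ)

/-- The curvelet `γ_{j,ℓ,k}(x) = (2π)⁻² ∫ e^{i x·ξ} (γ_{j,ℓ,k})^(ξ) dξ`. The integral is real, since
`χ_{j,ℓ}` is even and `u_{j,k}(-ξ)` is the conjugate of `u_{j,k}(ξ)`. -/
def curvelet (j ℓ : ℕ) (k : ℤ × ℤ) (x : E 2) : ℝ :=
  (((1 / (2 * Real.pi) ^ 2 : ℝ) : ℂ) *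
    ∫ ξ : E 2, Complex.exp (Complex.I * ((inner ℝ x ξ : ℝ) : ℂ)) * W.curveletHat j ℓ k ξ).re

/-- The conditions on the windows. `ω` is a nonzero bounded function with compact support in
`(0, ∞)`; `ν` is supported in `[-π, π]` and `ν(θ)² + ν(θ - π)² = 1` on `[0, π)`; the window of the
coarsest scale is bounded and even; and, for every scale and direction, `u_{j,k}` (`k ∈ ℤ²`) is an
orthonormal basis on a rectangle (of sides `2πδ₁ 2^{2j}`, `2πδ₂ 2^j`) that covers the rotated
support of the frequency window. -/
structure Admissible : Prop where
  measurable_ω : Measurable W.ω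
  measurable_ν : Measurable W.ν
  measurable_low : Measurable W.low
  bounded_ω : ∃ B : ℝ, ∀ r, |W.ω r| ≤ B
  support_ω : ∃ a b : ℝ, 0 < a ∧ ∀ r, W.ω r ≠ 0 → r ∈ Set.Icc a b
  nonzero_ω : ¬ (W.ω =ᵐ[volume] fun _ => 0)
  support_ν : ∀ z, W.ν z ≠ 0 → z ∈ Set.Icc (-Real.pi) Real.pi
  partition_ν : ∀ z ∈ Set.Ico 0 Real.pi, W.ν z ^ 2 + W.ν (z - Real.pi) ^ 2 = 1
  bounded_low : ∃ B : ℝ, ∀ ξ, |W.low ξ| ≤ B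
  even_low : ∀ ξ, W.low (-ξ) = W.low ξ
  pos_δ₁ : 0 < W.δ₁
  pos_δ₂ : 0 < W.δ₂
  covers : ∀ j ℓ : ℕ, ℓ < 2 ^ j → ∀ ξ, W.chi j ℓ ξ ≠ 0 →
    |rotStar (rotAngle j ℓ) ξ 0| ≤ Real.pi * W.δ₁ * 2 ^ (2 * j) ∧
    |rotStar (rotAngle j ℓ) ξ 1| ≤ Real.pi * W.δ₂ * 2 ^ j

/-! ### The regression model, the estimator and its risk -/

/-- The uniform distribution on `[-1,1]^2`. -/
def designLaw : Measure (E 2) := cond volume (cube 2)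

/-- The law of the independent pairs `(X_i, ξ_i)`, `i ∈ [n]`: `X_i` is uniform on the square and the
noise `ξ_i`, independent of `X_i`, is centred Gaussian with variance `σ²`. -/
def sampleLaw (n : ℕ) (σ : ℝ) : Measure (Fin n → E 2 × ℝ) :=
  Measure.pi fun _ => designLaw.prod (gaussianReal 0 (σ ^ 2).toNNReal)

/-- The empirical coefficient `(κ / n) ∑_i Y_i γ_{j,ℓ,k}(X_i)` with `Y_i = f(X_i) + ξ_i`. -/
def coeff (κ : ℝ) (f : E 2 → ℝ) {n : ℕ} (s : Fin n → E 2 × ℝ) (j ℓ : ℕ) (k : ℤ × ℤ) : ℝ :=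
  κ / n * ∑ i, (f (s i).1 + (s i).2) * W.curvelet j ℓ k (s i).1

/-- The truncated curvelet estimator: the sum of `ŵ_{j,ℓ,k} γ_{j,ℓ,k}(x)` over the scales
`j₀ ≤ j ≤ τ`, all the directions `0 ≤ ℓ < 2^j` and all the locations `k ∈ ℤ²`. -/
def estimator (κ : ℝ) (j₀ τ : ℕ) (f : E 2 → ℝ) {n : ℕ} (s : Fin n → E 2 × ℝ) (x : E 2) : ℝ :=
  ∑ j ∈ Finset.Icc j₀ τ, ∑ ℓ ∈ Finset.range (2 ^ j),
    ∑' k : ℤ × ℤ, W.coeff κ f s j ℓ k * W.curvelet j ℓ k x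

/-- The risk `E_f ‖f̂ - f‖²_{L²(P_X)}` of the truncated curvelet estimator, in `[0, ∞]`. -/
def risk (κ : ℝ) (j₀ τ : ℕ) (σ : ℝ) (n : ℕ) (f : E 2 → ℝ) : ENNReal :=
  ∫⁻ s, ∫⁻ x, ENNReal.ofReal ((W.estimator κ j₀ τ f s x - f x) ^ 2) ∂designLaw ∂(sampleLaw n σ)

end CurveletSystem

end

open scoped ComplexConjugate

/-! Summing over all locations `k` turns the estimator into a plain kernel estimator. In rotated box
coordinates the functions `u j k` are characters, so Parseval gives Σ_k γ(x)γ(y) as the inverse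
Fourier transform of χ² at y - x (`hasSum_curvelet`). Hence f̂(x) = (κ/n) Σ_i Y_i K(x - X_i), where
K has Fourier transform m = Σ_j Σ_ℓ χ_{j,ℓ}² (`estimator_eq`). The multiplier m is nonnegative,
bounded by a constant on each scale, and supported in a disc of radius of order 4^τ. The risk at x
then splits exactly into variance/n plus squared bias (`risk_eq`).

Variance: the noise alone contributes κ²σ² ∫ K²/n. The top scale already gives ∫ m of order 16^τ, so
K is at least of order 16^τ at distances up to order 4^{-τ}. There K² has integral of order
16^{2τ}·16^{-τ}, and the risk is at least c·16^τ/n (`exists_noise_le_risk`).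

Bias: the jump is tested against a function φ that is a Haar function of width s across the edge {0}
× [0,1] and constant along it. The step product f satisfies ∫ fφ = s. Its convolution with K is too
smooth to follow the jump: in frequency the pairing is at most a constant times s² ∫ m(ξ)/(1 + ξ₁²),
with ξ₁ the frequency along the edge, and this integral is of order 4^τ and not 16^τ
(`exists_integral_multiplier_le`). With s a small multiple of 4^{-τ} the convolution accounts for at
most half of ∫ fφ. As ∫ φ² = 2s, the squared bias is at least of order s, that is 4^{-τ}
(`exists_bias_le_risk`).

With t = 4^τ the risk is at least of order max(1/t, t²/n), and this is at least n^{-1/3} for every t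
(`rate_le_max`). -/

noncomputable section

/-! ### Parseval's identity on the unit box -/

section FourierBox

local instance measureSpaceUnitAddCircle : MeasureSpace UnitAddCircle :=
  ⟨AddCircle.haarAddCircle⟩

local instance isProbabilityMeasureUnitAddCircle :
    IsProbabilityMeasure (volume : Measure UnitAddCircle) :=
  inferInstanceAs (IsProbabilityMeasure AddCircle.haarAddCircle)

/-- The half-open unit square centred at the origin. -/
def unitBox : Set (Fin 2 → ℝ) :=
  {x | ∀ i, x i ∈ Set.Ioc ((fun _ => -1 / 2 : Fin 2 → ℝ) i) ((fun _ => -1 / 2 : Fin 2 → ℝ) i + 1)}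

/-- A function on the unit box, transplanted to the torus. -/
def toTorus (f : (Fin 2 → ℝ) → ℂ) (t : UnitAddTorus (Fin 2)) : ℂ :=
  f (UnitAddTorus.measurableEquivPiIoc (fun _ => -1 / 2 : Fin 2 → ℝ) t).1

theorem toTorus_coe (f : (Fin 2 → ℝ) → ℂ) {x : Fin 2 → ℝ} (hx : x ∈ unitBox) :
    toTorus f (fun i => (x i : UnitAddCircle)) = f x := by
  unfold toTorus
  congr 1
  have := (UnitAddTorus.measurableEquivPiIoc (fun _ => -1 / 2 : Fin 2 → ℝ)).apply_symm_apply ⟨x, hx⟩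
  rw [UnitAddTorus.coe_symm_measurableEquivPiIoc_apply] at this
  rw [this]

theorem measurable_toTorus {f : (Fin 2 → ℝ) → ℂ} (hf : Measurable f) :
    Measurable (toTorus f) :=
  hf.comp (measurable_subtype_coe.comp (MeasurableEquiv.measurable _))

theorem measurableSet_unitBox : MeasurableSet unitBox :=
  MeasurableSet.univ_pi' (fun _ => measurableSet_Ioc)

/-- The Fourier coefficients of a function on the unit box. -/
def boxCoeff (f : (Fin 2 → ℝ) → ℂ) (n : Fin 2 → ℤ) : ℂ :=
  ∫ x in unitBox, Complex.exp (-(2 * Real.pi * Complex.I * (n 0 * x 0 + n 1 * x 1))) * f x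

/-- Polarised Parseval on the torus, read off on a fundamental domain. Two different functions are
needed, because the windows of two points x and y will be paired. -/
theorem hasSum_boxCoeff {f g : (Fin 2 → ℝ) → ℂ} (hf : Measurable f) (hg : Measurable g)
    {C : ℝ} (hfC : ∀ x, ‖f x‖ ≤ C) (hgC : ∀ x, ‖g x‖ ≤ C) :
    HasSum (fun n => conj (boxCoeff f n) * boxCoeff g n) (∫ x in unitBox, conj (f x) * g x) := by
  have hmem : ∀ {f : (Fin 2 → ℝ) → ℂ}, Measurable f → (∀ x, ‖f x‖ ≤ C) →
      MemLp (toTorus f) 2 (volume : Measure (UnitAddTorus (Fin 2))) := fun {f} hf hC =>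
    MemLp.of_bound (measurable_toTorus hf).aestronglyMeasurable C
      (Filter.Eventually.of_forall fun t => hC _)
  have hcoef : ∀ {f : (Fin 2 → ℝ) → ℂ} (hf : Measurable f) (hC : ∀ x, ‖f x‖ ≤ C) (n : Fin 2 → ℤ),
      UnitAddTorus.mFourierCoeff ((hmem hf hC).toLp _) n = boxCoeff f n := by
    intro f hf hC n
    have h1 : UnitAddTorus.mFourierCoeff ((hmem hf hC).toLp _) n
        = UnitAddTorus.mFourierCoeff (toTorus f) n := by
      unfold UnitAddTorus.mFourierCoeff
      refine integral_congr_ae ?_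
      filter_upwards [(hmem hf hC).coeFn_toLp] with t ht
      rw [ht]
    rw [h1, UnitAddTorus.mFourierCoeff_eq_integral _ _ (fun _ => -1 / 2 : Fin 2 → ℝ)]
    refine setIntegral_congr_fun measurableSet_unitBox fun x hx => ?_
    rw [toTorus_coe f hx, smul_eq_mul]
    congr 1
    simp only [UnitAddTorus.mFourier, ContinuousMap.coe_mk, Fin.prod_univ_two, fourier_coe_apply,
      ← Complex.exp_add]
    congr 1
    simp
    ring
  have key := UnitAddTorus.hasSum_prod_mFourierCoeff ((hmem hf hfC).toLp _) ((hmem hg hgC).toLp _)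
  convert key using 1
  · funext n
    rw [← hcoef hf hfC n, ← hcoef hg hgC n]
  have : ∫ t, conj (((hmem hf hfC).toLp (toTorus f)) t) * ((hmem hg hgC).toLp (toTorus g)) t
      = ∫ t, conj (toTorus f t) * toTorus g t := by
    refine integral_congr_ae ?_
    filter_upwards [(hmem hf hfC).coeFn_toLp, (hmem hg hgC).coeFn_toLp] with t h1 h2
    rw [h1, h2]
  rw [this, UnitAddTorus.integral_preimage _ (fun _ => -1 / 2 : Fin 2 → ℝ)]
  refine setIntegral_congr_fun measurableSet_unitBox fun x hx => ?_
  rw [toTorus_coe f hx, toTorus_coe g hx]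

end FourierBox

/-! ### Plane coordinates and the frequency windows -/

/-- The plane as a product of two lines. -/
def planeEquiv : ℝ × ℝ ≃ᵐ E 2 :=
  MeasurableEquiv.finTwoArrow.symm.trans (MeasurableEquiv.toLp 2 (Fin 2 → ℝ))

@[simp] theorem planeEquiv_zero (p : ℝ × ℝ) : planeEquiv p 0 = p.1 := rfl

@[simp] theorem planeEquiv_one (p : ℝ × ℝ) : planeEquiv p 1 = p.2 := rfl

theorem measurePreserving_planeEquiv : MeasurePreserving planeEquiv volume volume :=
  (PiLp.volume_preserving_toLp (Fin 2)).comp (volume_preserving_finTwoArrow ℝ).symm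

theorem norm_planeEquiv (p : ℝ × ℝ) : ‖planeEquiv p‖ = Real.sqrt (p.1 ^ 2 + p.2 ^ 2) := by
  rw [EuclideanSpace.norm_eq]
  simp [Fin.sum_univ_two]

theorem measurable_coord (i : Fin 2) : Measurable fun ξ : E 2 => ξ i :=
  (EuclideanSpace.proj (𝕜 := ℝ) i).continuous.measurable

/-- The open first quadrant. -/
def quadrant : Set (E 2) := {ξ | 0 < ξ 0 ∧ 0 < ξ 1}

theorem measurableSet_quadrant : MeasurableSet quadrant :=
  (measurableSet_lt measurable_const (measurable_coord 0)).inter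
    (measurableSet_lt measurable_const (measurable_coord 1))

namespace CurveletSystem

variable {W : CurveletSystem}

theorem measurable_polarAngle : Measurable polarAngle := by
  unfold polarAngle
  simp only [Complex.mk_eq_add_mul_I]
  exact Complex.measurable_arg.comp
    ((Complex.measurable_ofReal.comp (measurable_coord 0)).add
      ((Complex.measurable_ofReal.comp (measurable_coord 1)).mul_const _))

theorem Admissible.measurable_chi (hW : W.Admissible) (j ℓ : ℕ) : Measurable (W.chi j ℓ) := by
  unfold chi
  by_cases hj : j = 0
  · simpa [hj] using hW.measurable_low
  · simp only [hj, if_false]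
    refine (hW.measurable_ω.comp (measurable_norm.div_const _)).mul
      (Finset.measurable_fun_sum _ fun m _ => ?_)
    exact hW.measurable_ν.comp (((measurable_polarAngle.add_const _).const_mul _).sub_const _)

theorem Admissible.exists_bound_ν (hW : W.Admissible) : ∃ B : ℝ, 0 ≤ B ∧ ∀ z, |W.ν z| ≤ B := by
  -- The partition identity bounds `ν` by 1 on [-π, π) only; the endpoint π is in the support but
  -- not covered by it.
  refine ⟨max 1 |W.ν Real.pi|, by positivity, fun z => ?_⟩
  by_cases hz : W.ν z = 0
  · rw [hz, abs_zero]; positivity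
  obtain ⟨h1, h2⟩ := hW.support_ν z hz
  rcases h2.eq_or_lt with rfl | h2
  · exact le_max_right _ _
  refine le_trans ?_ (le_max_left _ _)
  rw [← sq_le_one_iff_abs_le_one]
  rcases le_or_gt 0 z with h0 | h0
  · have := hW.partition_ν z ⟨h0, h2⟩
    nlinarith [sq_nonneg (W.ν (z - Real.pi))]
  · have := hW.partition_ν (z + Real.pi) ⟨by linarith, by linarith⟩
    rw [add_sub_cancel_right] at this
    nlinarith [sq_nonneg (W.ν (z + Real.pi))]

/-- The support lies in [π(ℓ - 1)/2^j, π(ℓ + 1)/2^j], and ℓ + 1 ≤ 2^j together with 2 ≤ 2^j puts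
this inside [-π/2, π]. This decides which representatives of an angle can contribute. -/
theorem Admissible.angular_eq_zero (hW : W.Admissible) {j ℓ : ℕ} (hj : j ≠ 0) (hℓ : ℓ < 2 ^ j)
    {z : ℝ} (hz : z < -(Real.pi / 2) ∨ Real.pi < z) : W.angular j ℓ z = 0 := by
  by_contra h
  obtain ⟨h1, h2⟩ := hW.support_ν _ h
  have hp := Real.pi_pos
  have hℓ' : (ℓ : ℝ) + 1 ≤ 2 ^ j := by exact_mod_cast hℓ
  have h2j : (2 : ℝ) ≤ 2 ^ j := by
    calc (2 : ℝ) = 2 ^ 1 := by norm_num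
      _ ≤ 2 ^ j := pow_le_pow_right₀ (by norm_num) (Nat.one_le_iff_ne_zero.2 hj)
  have hℓ0 : (0 : ℝ) ≤ ℓ := Nat.cast_nonneg _
  rcases hz with hz | hz
  · nlinarith [mul_nonneg hp.le hℓ0]
  · nlinarith [mul_nonneg hp.le (sub_nonneg.2 hℓ')]

theorem sum_Icc_neg_two_two (f : ℤ → ℝ) :
    ∑ m ∈ Finset.Icc (-2 : ℤ) 2, f m = f (-2) + f (-1) + f 0 + f 1 + f 2 := by
  rw [show Finset.Icc (-2 : ℤ) 2 = {-2, -1, 0, 1, 2} from rfl]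
  simp
  ring

theorem polarAngle_neg {ξ : E 2} (hξ : ξ ≠ 0) :
    polarAngle (-ξ) = polarAngle ξ - Real.pi ∨ polarAngle (-ξ) = polarAngle ξ + Real.pi := by
  have hne : (⟨ξ 0, ξ 1⟩ : ℂ) ≠ 0 := by
    intro h
    apply hξ
    ext i
    fin_cases i
    · exact congrArg Complex.re h
    · exact congrArg Complex.im h
  have hneg : polarAngle (-ξ) = Complex.arg (-⟨ξ 0, ξ 1⟩) := rfl
  rw [hneg]
  unfold polarAngle
  rcases lt_trichotomy (ξ 1) 0 with h | h | h
  · exact Or.inr (Complex.arg_neg_eq_arg_add_pi_of_im_neg h)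
  · rcases lt_trichotomy (ξ 0) 0 with h' | h' | h'
    · exact Or.inl (Complex.arg_neg_eq_arg_sub_pi_iff.2 (Or.inr ⟨h, h'⟩))
    · exact absurd (Complex.ext h' h) hne
    · exact Or.inr (Complex.arg_neg_eq_arg_add_pi_iff.2 (Or.inr ⟨h, h'⟩))
  · exact Or.inl (Complex.arg_neg_eq_arg_sub_pi_of_im_pos h)

/-- Passing to -ξ moves the polar angle by ±π, which shifts the sum over representatives by one
index. The term that enters and the term that leaves both vanish by the support of the angular
window. -/
theorem Admissible.chi_neg (hW : W.Admissible) {j ℓ : ℕ} (hℓ : ℓ < 2 ^ j) (ξ : E 2) :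
    W.chi j ℓ (-ξ) = W.chi j ℓ ξ := by
  by_cases hξ : ξ = 0
  · simp [hξ]
  unfold chi
  by_cases hj : j = 0
  · simpa [hj] using hW.even_low ξ
  simp only [hj, if_false, norm_neg]
  congr 1
  rw [sum_Icc_neg_two_two, sum_Icc_neg_two_two]
  have h1 : -Real.pi < polarAngle ξ := Complex.neg_pi_lt_arg _
  have h2 : polarAngle ξ ≤ Real.pi := Complex.arg_le_pi _
  have hp := Real.pi_pos
  rcases polarAngle_neg hξ with h | h <;> rw [h]
  · rw [hW.angular_eq_zero hj hℓ (z := polarAngle ξ - Real.pi + ((-2 : ℤ) : ℝ) * Real.pi)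
        (Or.inl (by push_cast; linarith)),
      hW.angular_eq_zero hj hℓ (z := polarAngle ξ + ((2 : ℤ) : ℝ) * Real.pi)
        (Or.inr (by push_cast; linarith))]
    push_cast
    ring_nf
  · rw [hW.angular_eq_zero hj hℓ (z := polarAngle ξ + Real.pi + ((2 : ℤ) : ℝ) * Real.pi)
        (Or.inr (by push_cast; linarith)),
      hW.angular_eq_zero hj hℓ (z := polarAngle ξ + ((-2 : ℤ) : ℝ) * Real.pi)
        (Or.inl (by push_cast; linarith))]
    push_cast
    ring_nf

/-- Bounded overlap: translates by multiples of π of a closed interval of length 2π cover a point at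
most three times. -/
theorem Admissible.sum_ν_sq_le (hW : W.Admissible) {B : ℝ} (hB : ∀ z, |W.ν z| ≤ B) (N : ℕ)
    (y : ℝ) : ∑ ℓ ∈ Finset.range N, W.ν (y - Real.pi * ℓ) ^ 2 ≤ 3 * B ^ 2 := by
  classical
  have hp := Real.pi_pos
  rw [← Finset.sum_filter_ne_zero]
  set S := (Finset.range N).filter fun ℓ : ℕ => W.ν (y - Real.pi * ℓ) ^ 2 ≠ 0 with hS
  have hcard : S.card ≤ 3 := by
    have hsub : S.card ≤ (Finset.Icc ⌈y / Real.pi - 1⌉ ⌊y / Real.pi + 1⌋).card := by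
      refine Finset.card_le_card_of_injOn (fun ℓ : ℕ => (ℓ : ℤ)) (fun ℓ hℓ => ?_)
        (fun a _ b _ h => by simpa using h)
      rw [hS, Finset.mem_coe, Finset.mem_filter] at hℓ
      obtain ⟨h1, h2⟩ := hW.support_ν _ (fun h => hℓ.2 (by rw [h]; norm_num))
      rw [Finset.coe_Icc, Set.mem_Icc, Int.ceil_le, Int.le_floor]
      push_cast
      constructor
      · rw [sub_le_iff_le_add, div_le_iff₀ hp]; linarith
      · rw [← sub_le_iff_le_add, le_div_iff₀ hp]; linarith
    refine hsub.trans ?_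
    rw [Int.card_Icc, Int.floor_add_one, Int.ceil_sub_one]
    have := Int.floor_le_ceil (y / Real.pi)
    omega
  calc ∑ ℓ ∈ S, W.ν (y - Real.pi * ℓ) ^ 2 ≤ ∑ _ℓ ∈ S, B ^ 2 :=
        Finset.sum_le_sum fun ℓ _ => sq_le_sq' (abs_le.1 (hB _)).1 (abs_le.1 (hB _)).2
    _ = S.card * B ^ 2 := by rw [Finset.sum_const, nsmul_eq_mul]
    _ ≤ 3 * B ^ 2 := by
        gcongr
        exact_mod_cast hcard

theorem Admissible.exists_bound_sum_chi_sq (hW : W.Admissible) :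
    ∃ B : ℝ, 0 < B ∧ ∀ j ξ, ∑ ℓ ∈ Finset.range (2 ^ j), W.chi j ℓ ξ ^ 2 ≤ B := by
  obtain ⟨Bω, hBω⟩ := hW.bounded_ω
  obtain ⟨Bl, hBl⟩ := hW.bounded_low
  obtain ⟨Bν, _, hBν⟩ := hW.exists_bound_ν
  -- One factor 5 is the Cauchy–Schwarz loss for five angle representatives, the other counts them;
  -- 3 is the overlap bound. The summand 1 only makes the constant positive.
  refine ⟨Bl ^ 2 + Bω ^ 2 * (5 * (5 * (3 * Bν ^ 2))) + 1, by positivity, fun j ξ => ?_⟩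
  by_cases hj : j = 0
  · subst hj
    have : W.low ξ ^ 2 ≤ Bl ^ 2 := sq_le_sq' (abs_le.1 (hBl _)).1 (abs_le.1 (hBl _)).2
    have h2 : 0 ≤ Bω ^ 2 * (5 * (5 * (3 * Bν ^ 2))) := by positivity
    simp only [pow_zero, Finset.range_one, Finset.sum_singleton, chi, if_true]
    linarith
  simp only [chi, hj, if_false, mul_pow, ← Finset.mul_sum]
  have h1 : W.ω (‖ξ‖ / 2 ^ (2 * j)) ^ 2 ≤ Bω ^ 2 :=
    sq_le_sq' (abs_le.1 (hBω _)).1 (abs_le.1 (hBω _)).2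
  have h2 : ∑ ℓ ∈ Finset.range (2 ^ j),
      (∑ m ∈ Finset.Icc (-2 : ℤ) 2, W.angular j ℓ (polarAngle ξ + m * Real.pi)) ^ 2
      ≤ 5 * (5 * (3 * Bν ^ 2)) := by
    calc _ ≤ ∑ ℓ ∈ Finset.range (2 ^ j), 5 * ∑ m ∈ Finset.Icc (-2 : ℤ) 2,
          W.angular j ℓ (polarAngle ξ + m * Real.pi) ^ 2 := Finset.sum_le_sum fun ℓ _ => by
            simpa using sq_sum_le_card_mul_sum_sq (s := Finset.Icc (-2 : ℤ) 2)
              (f := fun m : ℤ => W.angular j ℓ (polarAngle ξ + m * Real.pi))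
      _ = 5 * ∑ m ∈ Finset.Icc (-2 : ℤ) 2, ∑ ℓ ∈ Finset.range (2 ^ j),
          W.angular j ℓ (polarAngle ξ + m * Real.pi) ^ 2 := by
            rw [← Finset.mul_sum, Finset.sum_comm]
      _ ≤ 5 * ∑ m ∈ Finset.Icc (-2 : ℤ) 2, 3 * Bν ^ 2 := by
            gcongr with m _
            exact hW.sum_ν_sq_le hBν _ _
      _ = 5 * (5 * (3 * Bν ^ 2)) := by simp
  have h3 : 0 ≤ ∑ ℓ ∈ Finset.range (2 ^ j),
      (∑ m ∈ Finset.Icc (-2 : ℤ) 2, W.angular j ℓ (polarAngle ξ + m * Real.pi)) ^ 2 :=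
    Finset.sum_nonneg fun _ _ => sq_nonneg _
  have := mul_le_mul h1 h2 h3 (sq_nonneg _)
  nlinarith [sq_nonneg Bl]

/-- For angles θ in (0, π/2) only the representative m = 0 survives. With q = ⌊2^j θ/π⌋ the two
directions q and q + 1 produce exactly ν(z)² + ν(z - π)² = 1. -/
theorem Admissible.le_sum_chi_sq (hW : W.Admissible) {j : ℕ} (hj : j ≠ 0) {ξ : E 2}
    (hξ : ξ ∈ quadrant) :
    W.ω (‖ξ‖ / 2 ^ (2 * j)) ^ 2 ≤ ∑ ℓ ∈ Finset.range (2 ^ j), W.chi j ℓ ξ ^ 2 := by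
  have hp := Real.pi_pos
  have hθ0 : 0 < polarAngle ξ := by
    refine lt_of_le_of_ne (Complex.arg_nonneg_iff.2 hξ.2.le) fun h => ?_
    have := Complex.arg_eq_zero_iff.1 h.symm
    exact hξ.2.ne' this.2
  have hθ1 : polarAngle ξ < Real.pi / 2 :=
    (abs_lt.1 (Complex.abs_arg_lt_pi_div_two_iff.2 (Or.inl hξ.1))).2
  set θ := polarAngle ξ with hθ
  have hchi : ∀ ℓ < 2 ^ j, W.chi j ℓ ξ = W.ω (‖ξ‖ / 2 ^ (2 * j)) * W.angular j ℓ θ := by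
    intro ℓ hℓ
    simp only [chi, hj, if_false]
    congr 1
    rw [sum_Icc_neg_two_two, ← hθ,
      hW.angular_eq_zero hj hℓ (z := θ + ((-2 : ℤ) : ℝ) * Real.pi) (Or.inl (by push_cast; linarith)),
      hW.angular_eq_zero hj hℓ (z := θ + ((-1 : ℤ) : ℝ) * Real.pi) (Or.inl (by push_cast; linarith)),
      hW.angular_eq_zero hj hℓ (z := θ + ((1 : ℤ) : ℝ) * Real.pi) (Or.inr (by push_cast; linarith)),
      hW.angular_eq_zero hj hℓ (z := θ + ((2 : ℤ) : ℝ) * Real.pi) (Or.inr (by push_cast; linarith))]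
    simp
  set q := ⌊2 ^ j * θ / Real.pi⌋₊ with hq
  have hq0 : (q : ℝ) ≤ 2 ^ j * θ / Real.pi := Nat.floor_le (by positivity)
  have hq1 : 2 ^ j * θ / Real.pi < q + 1 := Nat.lt_floor_add_one _
  rw [le_div_iff₀ hp] at hq0
  rw [div_lt_iff₀ hp] at hq1
  -- θ < π/2 gives q < 2^{j-1}, so direction q + 1 exists and no wrap-around occurs; this is why the
  -- quadrant suffices and is used.
  have hlt : q + 1 < 2 ^ j := by
    have h2 : (q : ℝ) < 2 ^ j / 2 := by
      have : (2 : ℝ) ^ j * θ < 2 ^ j * (Real.pi / 2) := by gcongr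
      nlinarith
    obtain ⟨i, rfl⟩ := Nat.exists_eq_succ_of_ne_zero hj
    rw [Nat.succ_eq_add_one, pow_succ] at h2 ⊢
    have h3 : (q : ℝ) < 2 ^ i := by linarith
    have h4 : q < 2 ^ i := by exact_mod_cast h3
    have := Nat.one_le_two_pow (n := i)
    omega
  have hpart := hW.partition_ν (2 ^ j * θ - Real.pi * q) ⟨by linarith, by linarith⟩
  have hsub : ({q, q + 1} : Finset ℕ) ⊆ Finset.range (2 ^ j) := by
    intro i hi
    simp only [Finset.mem_insert, Finset.mem_singleton] at hi
    rw [Finset.mem_range]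
    omega
  have hsum := Finset.sum_le_sum_of_subset_of_nonneg hsub
    (f := fun ℓ => W.chi j ℓ ξ ^ 2) fun _ _ _ => sq_nonneg _
  refine le_trans (le_of_eq ?_) hsum
  rw [Finset.sum_pair (by omega), hchi q (by omega), hchi (q + 1) hlt, mul_pow, mul_pow, ← mul_add]
  have hang : W.angular j (q + 1) θ = W.ν (2 ^ j * θ - Real.pi * q - Real.pi) := by
    unfold angular
    congr 1
    push_cast
    ring
  rw [hang, angular, hpart, mul_one]

/-- In polar coordinates the integral is bounded below by the product of the angle π/2 and ∫ r ω(r)²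
dr. The latter is positive because `ω` lives on (0, ∞), where the weight r does not vanish, and is
not a.e. zero. -/
theorem Admissible.setLIntegral_ω_pos (hW : W.Admissible) :
    0 < ∫⁻ ξ in quadrant, ENNReal.ofReal (W.ω ‖ξ‖ ^ 2) := by
  have hp := Real.pi_pos
  set S : Set (ℝ × ℝ) := {p | 0 < p.1 ∧ 0 < p.2} with hS
  have hmS : MeasurableSet S := (measurableSet_lt measurable_const measurable_fst).inter
    (measurableSet_lt measurable_const measurable_snd)
  have h1 : ∫⁻ ξ in quadrant, ENNReal.ofReal (W.ω ‖ξ‖ ^ 2)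
      = ∫⁻ p, S.indicator (fun p => ENNReal.ofReal (W.ω (Real.sqrt (p.1 ^ 2 + p.2 ^ 2)) ^ 2)) p := by
    rw [← lintegral_indicator measurableSet_quadrant,
      ← measurePreserving_planeEquiv.lintegral_comp_emb planeEquiv.measurableEmbedding]
    refine lintegral_congr fun p => ?_
    by_cases hpS : p ∈ S
    · rw [Set.indicator_of_mem hpS, Set.indicator_of_mem (show planeEquiv p ∈ quadrant from hpS),
        norm_planeEquiv]
    · rw [Set.indicator_of_notMem hpS,
        Set.indicator_of_notMem (show planeEquiv p ∉ quadrant from hpS)]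
  rw [h1, ← lintegral_comp_polarCoord_symm]
  have h2 : ∫⁻ p in polarCoord.target, (ENNReal.ofReal p.1 * ENNReal.ofReal (W.ω p.1 ^ 2)) *
      (Set.Ioo 0 (Real.pi / 2)).indicator 1 p.2
      ≤ ∫⁻ p in polarCoord.target, ENNReal.ofReal p.1 • S.indicator
        (fun p => ENNReal.ofReal (W.ω (Real.sqrt (p.1 ^ 2 + p.2 ^ 2)) ^ 2)) (polarCoord.symm p) := by
    refine setLIntegral_mono' polarCoord.open_target.measurableSet fun p hpt => ?_
    by_cases hθ : p.2 ∈ Set.Ioo 0 (Real.pi / 2)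
    · have hr : 0 < p.1 := hpt.1
      have hmem : polarCoord.symm p ∈ S :=
        ⟨mul_pos hr (Real.cos_pos_of_mem_Ioo ⟨by linarith [hθ.1], hθ.2⟩),
          mul_pos hr (Real.sin_pos_of_pos_of_lt_pi hθ.1 (by linarith [hθ.2]))⟩
      rw [Set.indicator_of_mem hθ, Set.indicator_of_mem hmem]
      have : Real.sqrt ((polarCoord.symm p).1 ^ 2 + (polarCoord.symm p).2 ^ 2) = p.1 := by
        simp only [polarCoord_symm_apply]
        rw [show (p.1 * Real.cos p.2) ^ 2 + (p.1 * Real.sin p.2) ^ 2 = p.1 ^ 2 by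
          linear_combination p.1 ^ 2 * Real.sin_sq_add_cos_sq p.2, Real.sqrt_sq hr.le]
      rw [this, Pi.one_apply, mul_one, smul_eq_mul]
    · rw [Set.indicator_of_notMem hθ, mul_zero]
      exact bot_le
  refine lt_of_lt_of_le ?_ h2
  have hm1 : Measurable fun r : ℝ => ENNReal.ofReal r * ENNReal.ofReal (W.ω r ^ 2) :=
    ENNReal.measurable_ofReal.mul (ENNReal.measurable_ofReal.comp (hW.measurable_ω.pow_const 2))
  rw [polarCoord_target, Measure.volume_eq_prod, ← Measure.prod_restrict,
    lintegral_prod_mul hm1.aemeasurable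
      (measurable_one.indicator measurableSet_Ioo).aemeasurable]
  refine ENNReal.mul_pos ?_ ?_
  · intro h0
    rw [lintegral_eq_zero_iff hm1] at h0
    apply hW.nonzero_ω
    have h0' := (ae_restrict_iff' measurableSet_Ioi).1 h0
    obtain ⟨a, b, ha, hab⟩ := hW.support_ω
    filter_upwards [h0'] with r hr
    by_contra hne
    have hr0 : 0 < r := ha.trans_le (hab r hne).1
    have := hr hr0
    simp only [Pi.zero_apply, mul_eq_zero, ENNReal.ofReal_eq_zero] at this
    rcases this with h | h
    · linarith
    · exact absurd h (not_le.2 (by positivity))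
  · rw [lintegral_indicator measurableSet_Ioo]
    simp only [Pi.one_apply, lintegral_one, Measure.restrict_restrict measurableSet_Ioo,
      Measure.restrict_apply_univ]
    rw [Set.inter_eq_left.2 (Set.Ioo_subset_Ioo (by linarith) (by linarith)), Real.volume_Ioo]
    simp [hp]

end CurveletSystem

/-! ### Rotated boxes and the summation over locations -/

/-- Rotated rectangular coordinates on the plane. -/
def boxMap (θ a b : ℝ) (t : Fin 2 → ℝ) : E 2 :=
  !₂[Real.cos θ * (a * t 0) - Real.sin θ * (b * t 1),
    Real.sin θ * (a * t 0) + Real.cos θ * (b * t 1)]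

theorem rotStar_boxMap_zero (θ a b : ℝ) (t : Fin 2 → ℝ) :
    CurveletSystem.rotStar θ (boxMap θ a b t) 0 = a * t 0 := by
  simp [CurveletSystem.rotStar, boxMap]
  linear_combination a * t 0 * Real.sin_sq_add_cos_sq θ

theorem rotStar_boxMap_one (θ a b : ℝ) (t : Fin 2 → ℝ) :
    CurveletSystem.rotStar θ (boxMap θ a b t) 1 = b * t 1 := by
  simp [CurveletSystem.rotStar, boxMap]
  linear_combination b * t 1 * Real.sin_sq_add_cos_sq θ

theorem norm_rotStar (θ : ℝ) (ξ : E 2) : ‖CurveletSystem.rotStar θ ξ‖ = ‖ξ‖ := by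
  rw [EuclideanSpace.norm_eq, EuclideanSpace.norm_eq]
  congr 1
  simp [CurveletSystem.rotStar, Fin.sum_univ_two]
  linear_combination (ξ 0 ^ 2 + ξ 1 ^ 2) * Real.sin_sq_add_cos_sq θ

theorem norm_le_add_abs (η : E 2) : ‖η‖ ≤ |η 0| + |η 1| := by
  rw [EuclideanSpace.norm_eq, Fin.sum_univ_two]
  refine Real.sqrt_le_sqrt (show _ ≤ (|η 0| + |η 1|) ^ 2 by
    simp only [Real.norm_eq_abs]
    nlinarith [abs_nonneg (η 0), abs_nonneg (η 1)]) |>.trans ?_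
  rw [Real.sqrt_sq (by positivity)]

theorem measurable_boxMap (θ a b : ℝ) : Measurable (boxMap θ a b) := by
  unfold boxMap
  refine (PiLp.continuous_toLp 2 (fun _ : Fin 2 => ℝ)).measurable.comp
    (measurable_pi_lambda _ fun i => ?_)
  fin_cases i <;> simp <;> fun_prop

theorem integral_boxMap (θ : ℝ) {a b : ℝ} (ha : 0 < a) (hb : 0 < b) {g : E 2 → ℂ}
    (hg : Measurable g) : ∫ ξ, g ξ = ((a * b : ℝ) : ℂ) * ∫ t, g (boxMap θ a b t) := by
  set A : Matrix (Fin 2) (Fin 2) ℝ :=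
    !![Real.cos θ * a, -(Real.sin θ * b); Real.sin θ * a, Real.cos θ * b] with hA
  have hdet : A.det = a * b := by
    rw [hA, Matrix.det_fin_two_of]
    linear_combination a * b * Real.sin_sq_add_cos_sq θ
  have hab : 0 < a * b := mul_pos ha hb
  have hbm : ∀ t, boxMap θ a b t = WithLp.toLp 2 (Matrix.toLin' A t) := by
    intro t
    ext i
    fin_cases i <;> simp [boxMap, hA, Matrix.mulVec, dotProduct, Fin.sum_univ_two] <;> ring
  have hme : MeasurableEmbedding (WithLp.toLp 2 : (Fin 2 → ℝ) → E 2) :=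
    (MeasurableEquiv.toLp 2 (Fin 2 → ℝ)).measurableEmbedding
  rw [← (PiLp.volume_preserving_toLp (Fin 2)).integral_comp hme]
  have hmap := Real.map_matrix_volume_pi_eq_smul_volume_pi (M := A) (by rw [hdet]; exact hab.ne')
  have hgm : Measurable fun x : Fin 2 → ℝ => g (WithLp.toLp 2 x) := hg.comp hme.measurable
  have h2 := integral_map (μ := volume) (φ := Matrix.toLin' A)
    (LinearMap.continuous_of_finiteDimensional _).measurable.aemeasurable
    (f := fun x => g (WithLp.toLp 2 x)) hgm.aestronglyMeasurable
  rw [hmap, integral_smul_measure, hdet, ENNReal.toReal_ofReal (abs_nonneg _),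
    abs_of_pos (inv_pos.2 hab)] at h2
  simp only [hbm]
  rw [← h2, Complex.real_smul, ← mul_assoc, ← Complex.ofReal_mul, mul_inv_cancel₀ hab.ne',
    Complex.ofReal_one, one_mul]

/-- The covering hypothesis on the windows gives support in the closed box, while the fundamental
domain is half-open; the difference is a null set. -/
theorem setIntegral_unitBox {g : (Fin 2 → ℝ) → ℂ}
    (hg : ∀ t, g t ≠ 0 → ∀ i, |t i| ≤ 1 / 2) : ∫ t in unitBox, g t = ∫ t, g t := by
  have h1 : unitBox = Set.univ.pi fun i => Set.Ioc ((fun _ => -1 / 2 : Fin 2 → ℝ) i)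
      ((fun _ => 1 / 2 : Fin 2 → ℝ) i) := by
    ext t
    simp only [unitBox, Set.mem_ofPred_eq, Set.mem_pi, Set.mem_univ, true_implies]
    norm_num
  rw [h1, setIntegral_congr_set (volume_pi (α := fun _ : Fin 2 => ℝ) ▸
    Measure.univ_pi_Ioc_ae_eq_Icc)]
  refine setIntegral_eq_integral_of_forall_compl_eq_zero fun t ht => ?_
  by_contra hne
  refine ht ⟨fun i => ?_, fun i => ?_⟩
  · have := (abs_le.1 (hg t hne i)).1
    simp only
    linarith
  · exact (abs_le.1 (hg t hne i)).2

namespace CurveletSystem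

variable {W : CurveletSystem}

/-- The radius of a disc containing the frequency support of all the curvelets of scale `0`. -/
def radius (W : CurveletSystem) : ℝ := Real.pi * (W.δ₁ + W.δ₂)

theorem Admissible.radius_pos (hW : W.Admissible) : 0 < W.radius :=
  mul_pos Real.pi_pos (add_pos hW.pos_δ₁ hW.pos_δ₂)

/-- The parabolic shape of the rectangle is given up here (2^j ≤ 4^j): summed over all directions,
the windows of a scale are only seen through a disc. -/
theorem Admissible.norm_le_of_chi_ne_zero (hW : W.Admissible) {j ℓ : ℕ} (hℓ : ℓ < 2 ^ j) {ξ : E 2}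
    (hξ : W.chi j ℓ ξ ≠ 0) : ‖ξ‖ ≤ W.radius * 4 ^ j := by
  obtain ⟨h1, h2⟩ := hW.covers j ℓ hℓ ξ hξ
  have h4 : (2 : ℝ) ^ (2 * j) = 4 ^ j := by rw [pow_mul]; norm_num
  have h24 : (2 : ℝ) ^ j ≤ 4 ^ j := by gcongr; norm_num
  rw [h4] at h1
  rw [← norm_rotStar (rotAngle j ℓ)]
  set η := rotStar (rotAngle j ℓ) ξ
  have hp := Real.pi_pos
  have hsum := norm_le_add_abs η
  have h3 : Real.pi * W.δ₂ * 2 ^ j ≤ Real.pi * W.δ₂ * 4 ^ j := by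
    have := hW.pos_δ₂
    gcongr
  unfold radius
  linarith

theorem Admissible.exists_bound_chi (hW : W.Admissible) :
    ∃ B : ℝ, 0 < B ∧ ∀ j ℓ, ℓ < 2 ^ j → ∀ ξ, |W.chi j ℓ ξ| ≤ B := by
  obtain ⟨B, hB, hle⟩ := hW.exists_bound_sum_chi_sq
  refine ⟨Real.sqrt B, Real.sqrt_pos.2 hB, fun j ℓ hℓ ξ => Real.le_sqrt_of_sq_le ?_⟩
  rw [sq_abs]
  exact (Finset.single_le_sum (f := fun ℓ => W.chi j ℓ ξ ^ 2) (fun _ _ => sq_nonneg _)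
    (Finset.mem_range.2 hℓ)).trans (hle j ξ)

/-- The reproducing kernel of the curvelets of a fixed scale and direction. -/
def directionKernel (W : CurveletSystem) (j ℓ : ℕ) (z : E 2) : ℝ :=
  1 / (2 * Real.pi) ^ 2 * ∫ ξ : E 2, Real.cos (inner ℝ z ξ) * W.chi j ℓ ξ ^ 2

/-- The complex-valued integral whose real part is the curvelet. -/
def complexCurvelet (W : CurveletSystem) (j ℓ : ℕ) (k : ℤ × ℤ) (x : E 2) : ℂ :=
  ((1 / (2 * Real.pi) ^ 2 : ℝ) : ℂ) *
    ∫ ξ : E 2, Complex.exp (Complex.I * ((inner ℝ x ξ : ℝ) : ℂ)) * W.curveletHat j ℓ k ξ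

theorem curvelet_eq_re (j ℓ : ℕ) (k : ℤ × ℤ) (x : E 2) :
    W.curvelet j ℓ k x = (W.complexCurvelet j ℓ k x).re := rfl

theorem rotStar_neg (θ : ℝ) (ξ : E 2) : rotStar θ (-ξ) = -rotStar θ ξ := by
  ext i
  fin_cases i <;> simp [rotStar] <;> ring

theorem u_neg (j : ℕ) (k : ℤ × ℤ) (ξ : E 2) : W.u j k (-ξ) = conj (W.u j k ξ) := by
  simp only [u, map_mul, ← Complex.exp_conj, Complex.conj_ofReal, Complex.conj_I]
  congr 1
  · congr 1
    congr 1
    simp only [PiLp.neg_apply]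
    push_cast
    ring
  all_goals
    congr 1
    simp only [PiLp.neg_apply]
    push_cast
    ring

/-- The substitution ξ ↦ -ξ, with χ even and u(-ξ) conjugate to u(ξ). Taking real parts therefore
loses nothing, and a product of two curvelets becomes a summand conj(a)·b of Parseval. -/
theorem Admissible.conj_complexCurvelet (hW : W.Admissible) {j ℓ : ℕ} (hℓ : ℓ < 2 ^ j)
    (k : ℤ × ℤ) (x : E 2) : conj (W.complexCurvelet j ℓ k x) = W.complexCurvelet j ℓ k x := by
  unfold complexCurvelet
  rw [map_mul, Complex.conj_ofReal, ← integral_conj,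
    ← integral_neg_eq_self (fun ξ : E 2 =>
      Complex.exp (Complex.I * ((inner ℝ x ξ : ℝ) : ℂ)) * W.curveletHat j ℓ k ξ)]
  congr 1
  refine integral_congr_ae (Filter.Eventually.of_forall fun ξ => ?_)
  simp only [curveletHat, map_mul, ← Complex.exp_conj, Complex.conj_ofReal, Complex.conj_I,
    rotStar_neg, u_neg, hW.chi_neg hℓ, inner_neg_right]
  congr 2
  push_cast
  ring

theorem Admissible.ofReal_curvelet (hW : W.Admissible) {j ℓ : ℕ} (hℓ : ℓ < 2 ^ j)
    (k : ℤ × ℤ) (x : E 2) : (W.curvelet j ℓ k x : ℂ) = W.complexCurvelet j ℓ k x := by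
  rw [curvelet_eq_re]
  exact Complex.conj_eq_iff_re.1 (hW.conj_complexCurvelet hℓ k x)

/-- The length of the first side of the frequency rectangle. -/
def sideOne (W : CurveletSystem) (j : ℕ) : ℝ := 2 * Real.pi * W.δ₁ * 2 ^ (2 * j)

/-- The length of the second side of the frequency rectangle. -/
def sideTwo (W : CurveletSystem) (j : ℕ) : ℝ := 2 * Real.pi * W.δ₂ * 2 ^ j

/-- The modulated frequency window in the coordinates of the unit box. -/
def boxWindow (W : CurveletSystem) (j ℓ : ℕ) (x : E 2) (t : Fin 2 → ℝ) : ℂ :=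
  Complex.exp (Complex.I * ((inner ℝ x
      (boxMap (rotAngle j ℓ) (W.sideOne j) (W.sideTwo j) t) : ℝ) : ℂ)) *
    (W.chi j ℓ (boxMap (rotAngle j ℓ) (W.sideOne j) (W.sideTwo j) t) : ℂ) *
    Complex.exp (Complex.I * ((Real.pi * t 0 : ℝ) : ℂ))

theorem Admissible.sideOne_pos (hW : W.Admissible) (j : ℕ) : 0 < W.sideOne j := by
  have := hW.pos_δ₁
  have := Real.pi_pos
  unfold sideOne
  positivity

theorem Admissible.sideTwo_pos (hW : W.Admissible) (j : ℕ) : 0 < W.sideTwo j := by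
  have := hW.pos_δ₂
  have := Real.pi_pos
  unfold sideTwo
  positivity

theorem Admissible.abs_le_half_of_chi_ne_zero (hW : W.Admissible) {j ℓ : ℕ} (hℓ : ℓ < 2 ^ j)
    {t : Fin 2 → ℝ} (ht : W.chi j ℓ (boxMap (rotAngle j ℓ) (W.sideOne j) (W.sideTwo j) t) ≠ 0)
    (i : Fin 2) : |t i| ≤ 1 / 2 := by
  obtain ⟨h1, h2⟩ := hW.covers j ℓ hℓ _ ht
  have ha := hW.sideOne_pos j
  have hb := hW.sideTwo_pos j
  rw [rotStar_boxMap_zero, abs_mul, abs_of_pos ha] at h1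
  rw [rotStar_boxMap_one, abs_mul, abs_of_pos hb] at h2
  have e1 : Real.pi * W.δ₁ * 2 ^ (2 * j) = W.sideOne j * (1 / 2) := by unfold sideOne; ring
  have e2 : Real.pi * W.δ₂ * 2 ^ j = W.sideTwo j * (1 / 2) := by unfold sideTwo; ring
  rw [e1] at h1
  rw [e2] at h2
  fin_cases i
  · exact le_of_mul_le_mul_left h1 ha
  · exact le_of_mul_le_mul_left h2 hb

theorem measurable_exp_inner (x : E 2) :
    Measurable fun ξ : E 2 => Complex.exp (Complex.I * ((inner ℝ x ξ : ℝ) : ℂ)) := by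
  have : Continuous fun ξ : E 2 => Complex.exp (Complex.I * ((inner ℝ x ξ : ℝ) : ℂ)) := by
    fun_prop
  exact this.measurable

theorem measurable_u_rotStar (W : CurveletSystem) (j : ℕ) (k : ℤ × ℤ) (θ : ℝ) :
    Measurable fun ξ : E 2 => W.u j k (rotStar θ ξ) := by
  have h0 := measurable_coord 0
  have h1 := measurable_coord 1
  simp only [u, rotStar, PiLp.toLp_apply, Matrix.cons_val_zero, Matrix.cons_val_one]
  fun_prop

theorem Admissible.measurable_boxWindow (hW : W.Admissible) (j ℓ : ℕ) (x : E 2) :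
    Measurable (W.boxWindow j ℓ x) := by
  have hm := measurable_boxMap (rotAngle j ℓ) (W.sideOne j) (W.sideTwo j)
  unfold boxWindow
  refine (((measurable_exp_inner x).comp hm).mul
    (Complex.measurable_ofReal.comp ((hW.measurable_chi j ℓ).comp hm))).mul ?_
  fun_prop

theorem norm_boxWindow (j ℓ : ℕ) (x : E 2) (t : Fin 2 → ℝ) :
    ‖W.boxWindow j ℓ x t‖ =
      |W.chi j ℓ (boxMap (rotAngle j ℓ) (W.sideOne j) (W.sideTwo j) t)| := by
  unfold boxWindow
  rw [norm_mul, norm_mul, mul_comm Complex.I, mul_comm Complex.I, Complex.norm_exp_ofReal_mul_I,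
    Complex.norm_exp_ofReal_mul_I, Complex.norm_real, one_mul, mul_one, Real.norm_eq_abs]

theorem Admissible.u_const (hW : W.Admissible) (j : ℕ) :
    (2 : ℝ) ^ (-(3 * (j : ℝ) / 2)) / (2 * Real.pi * Real.sqrt (W.δ₁ * W.δ₂))
      = 1 / Real.sqrt (W.sideOne j * W.sideTwo j) := by
  have h1 := hW.pos_δ₁
  have h2 := hW.pos_δ₂
  have hp := Real.pi_pos
  have h3 : W.sideOne j * W.sideTwo j
      = (2 * Real.pi * (2 : ℝ) ^ (3 * (j : ℝ) / 2)) ^ 2 * (W.δ₁ * W.δ₂) := by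
    have : ((2 : ℝ) ^ (3 * (j : ℝ) / 2)) ^ 2 = 2 ^ (2 * j) * 2 ^ j := by
      rw [← Real.rpow_natCast, ← Real.rpow_mul (by norm_num), ← pow_add, ← Real.rpow_natCast]
      congr 1
      push_cast
      ring
    rw [mul_pow, this]
    unfold sideOne sideTwo
    ring
  rw [h3, Real.sqrt_mul (sq_nonneg _), Real.sqrt_sq (by positivity), Real.rpow_neg (by norm_num)]
  field_simp

/-- In box coordinates `u j k` is, up to normalisation, the character of index k times e^{iπt₀}, the
latter coming from the shift k₁ + 1/2. That phase does not depend on k and is part of `boxWindow`;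
the sign in -k comes from the convention for Fourier coefficients. -/
theorem Admissible.complexCurvelet_eq (hW : W.Admissible) {j ℓ : ℕ} (hℓ : ℓ < 2 ^ j)
    (k : ℤ × ℤ) (x : E 2) : W.complexCurvelet j ℓ k x =
      ((Real.sqrt (W.sideOne j * W.sideTwo j) / (2 * Real.pi) : ℝ) : ℂ) *
        boxCoeff (W.boxWindow j ℓ x) ![-k.1, -k.2] := by
  have ha := hW.sideOne_pos j
  have hb := hW.sideTwo_pos j
  have hab : 0 < W.sideOne j * W.sideTwo j := mul_pos ha hb
  have hp := Real.pi_pos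
  have hd1 := hW.pos_δ₁
  have hd2 := hW.pos_δ₂
  have hg : Measurable fun ξ : E 2 =>
      Complex.exp (Complex.I * ((inner ℝ x ξ : ℝ) : ℂ)) * W.curveletHat j ℓ k ξ :=
    (measurable_exp_inner x).mul ((Complex.measurable_ofReal.comp
      ((hW.measurable_chi j ℓ).const_mul _)).mul (measurable_u_rotStar W j k _))
  unfold complexCurvelet boxCoeff
  rw [integral_boxMap (rotAngle j ℓ) ha hb hg, setIntegral_unitBox, ← integral_const_mul,
    ← integral_const_mul, ← integral_const_mul]
  · refine integral_congr_ae (Filter.Eventually.of_forall fun t => ?_)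
    simp only [curveletHat, boxWindow, u, rotStar_boxMap_zero, rotStar_boxMap_one, hW.u_const j]
    set e := Complex.exp (Complex.I * ((inner ℝ x
      (boxMap (rotAngle j ℓ) (W.sideOne j) (W.sideTwo j) t) : ℝ) : ℂ))
    set χ := W.chi j ℓ (boxMap (rotAngle j ℓ) (W.sideOne j) (W.sideTwo j) t)
    have hexp : Complex.exp (Complex.I * ((((k.1 : ℝ) + 1 / 2) *
          (W.sideOne j * t 0 / (2 ^ (2 * j) * W.δ₁)) : ℝ) : ℂ)) *
        Complex.exp (Complex.I * (((k.2 : ℝ) * (W.sideTwo j * t 1 / (2 ^ j * W.δ₂)) : ℝ) : ℂ))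
        = Complex.exp (-(2 * Real.pi * Complex.I * (((![-k.1, -k.2] : Fin 2 → ℤ) 0 : ℂ) * t 0 +
            ((![-k.1, -k.2] : Fin 2 → ℤ) 1 : ℂ) * t 1))) *
          Complex.exp (Complex.I * ((Real.pi * t 0 : ℝ) : ℂ)) := by
      rw [← Complex.exp_add, ← Complex.exp_add]
      congr 1
      have e1 : W.sideOne j * t 0 / (2 ^ (2 * j) * W.δ₁) = 2 * Real.pi * t 0 := by
        unfold sideOne; field_simp
      have e2 : W.sideTwo j * t 1 / (2 ^ j * W.δ₂) = 2 * Real.pi * t 1 := by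
        unfold sideTwo; field_simp
      rw [e1, e2]
      simp only [Matrix.cons_val_zero, Matrix.cons_val_one]
      push_cast
      ring
    have hc : 1 / (2 * Real.pi) ^ 2 * (W.sideOne j * W.sideTwo j) * (2 * Real.pi * χ) *
        (1 / Real.sqrt (W.sideOne j * W.sideTwo j))
        = Real.sqrt (W.sideOne j * W.sideTwo j) / (2 * Real.pi) * χ := by
      have hs : Real.sqrt (W.sideOne j * W.sideTwo j) ≠ 0 := (Real.sqrt_pos.2 hab).ne'
      have hsq := Real.mul_self_sqrt hab.le
      nth_rw 1 [← hsq]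
      field_simp
    have hc' := congrArg (fun r : ℝ => (r : ℂ)) hc
    simp only [Complex.ofReal_mul] at hc'
    rw [mul_assoc (((1 / Real.sqrt (W.sideOne j * W.sideTwo j) : ℝ)) : ℂ), hexp]
    simp only [Complex.ofReal_mul]
    simp only [Complex.ofReal_mul] at *
    linear_combination (e * Complex.exp (-(2 * Real.pi * Complex.I * (((![-k.1, -k.2] :
      Fin 2 → ℤ) 0 : ℂ) * t 0 + ((![-k.1, -k.2] : Fin 2 → ℤ) 1 : ℂ) * t 1))) *
          Complex.exp (Complex.I * ((Real.pi : ℂ) * t 0))) * hc'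
  · intro t ht
    refine hW.abs_le_half_of_chi_ne_zero hℓ (fun h => ht ?_)
    rw [boxWindow, h]
    simp

theorem Admissible.integrable_mul_chi_sq (hW : W.Admissible) {j ℓ : ℕ} (hℓ : ℓ < 2 ^ j) :
    Integrable fun ξ => W.chi j ℓ ξ ^ 2 := by
  obtain ⟨B, _, hB⟩ := hW.exists_bound_chi
  have hon : IntegrableOn (fun ξ => W.chi j ℓ ξ ^ 2)
      (Metric.closedBall (0 : E 2) (W.radius * 4 ^ j)) := by
    refine Measure.integrableOn_of_bounded measure_closedBall_lt_top.ne
      ((hW.measurable_chi j ℓ).pow_const 2).aestronglyMeasurable (M := B ^ 2)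
      (Filter.Eventually.of_forall fun ξ => ?_)
    rw [Real.norm_eq_abs, abs_pow]
    exact pow_le_pow_left₀ (abs_nonneg _) (hB j ℓ hℓ ξ) 2
  refine (integrableOn_iff_integrable_of_support_subset fun ξ hξ => ?_).1 hon
  rw [mem_closedBall_zero_iff]
  exact hW.norm_le_of_chi_ne_zero hℓ fun h => hξ (by simp [h])

/-- Parseval for the windows of x and y. In the product of one with the conjugate of the other the
half-shift phase cancels and e^{i(y-x)·ξ} χ² is left, so the sum over locations is translation
invariant. -/
theorem Admissible.hasSum_curvelet (hW : W.Admissible) {j ℓ : ℕ} (hℓ : ℓ < 2 ^ j) (x y : E 2) :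
    HasSum (fun k => W.curvelet j ℓ k x * W.curvelet j ℓ k y) (W.directionKernel j ℓ (y - x)) := by
  have ha := hW.sideOne_pos j
  have hb := hW.sideTwo_pos j
  have hab : 0 < W.sideOne j * W.sideTwo j := mul_pos ha hb
  obtain ⟨B, _, hB⟩ := hW.exists_bound_chi
  have hbd : ∀ x t, ‖W.boxWindow j ℓ x t‖ ≤ B := fun x t => by
    rw [norm_boxWindow]; exact hB j ℓ hℓ _
  have hsum := hasSum_boxCoeff (hW.measurable_boxWindow j ℓ x) (hW.measurable_boxWindow j ℓ y)
    (hbd x) (hbd y)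
  let e : ℤ × ℤ ≃ (Fin 2 → ℤ) := (Equiv.neg (ℤ × ℤ)).trans (finTwoArrowEquiv ℤ).symm
  have he : ∀ k : ℤ × ℤ, e k = ![-k.1, -k.2] := fun k => rfl
  have hsum2 := ((e.hasSum_iff).2 hsum).mul_left
    ((W.sideOne j * W.sideTwo j / (2 * Real.pi) ^ 2 : ℝ) : ℂ)
  have hterm : ∀ k : ℤ × ℤ, ((W.sideOne j * W.sideTwo j / (2 * Real.pi) ^ 2 : ℝ) : ℂ) *
      ((fun n => conj (boxCoeff (W.boxWindow j ℓ x) n) * boxCoeff (W.boxWindow j ℓ y) n) ∘ e) k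
      = ((W.curvelet j ℓ k x * W.curvelet j ℓ k y : ℝ) : ℂ) := by
    intro k
    rw [Complex.ofReal_mul, hW.ofReal_curvelet hℓ k y, hW.ofReal_curvelet hℓ k x,
      ← hW.conj_complexCurvelet hℓ k x, hW.complexCurvelet_eq hℓ, hW.complexCurvelet_eq hℓ,
      map_mul, Complex.conj_ofReal, Function.comp_apply, he]
    have : (W.sideOne j * W.sideTwo j / (2 * Real.pi) ^ 2)
        = Real.sqrt (W.sideOne j * W.sideTwo j) / (2 * Real.pi) *
          (Real.sqrt (W.sideOne j * W.sideTwo j) / (2 * Real.pi)) := by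
      rw [div_mul_div_comm, Real.mul_self_sqrt hab.le, sq]
    rw [this, Complex.ofReal_mul]
    ring
  have hg : Measurable fun ξ : E 2 =>
      Complex.exp (Complex.I * ((inner ℝ (y - x) ξ : ℝ) : ℂ)) * ((W.chi j ℓ ξ ^ 2 : ℝ) : ℂ) :=
    (measurable_exp_inner _).mul (Complex.measurable_ofReal.comp
      ((hW.measurable_chi j ℓ).pow_const 2))
  have hint : ((W.sideOne j * W.sideTwo j / (2 * Real.pi) ^ 2 : ℝ) : ℂ) *
      ∫ t in unitBox, conj (W.boxWindow j ℓ x t) * W.boxWindow j ℓ y t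
      = ((1 / (2 * Real.pi) ^ 2 : ℝ) : ℂ) * ∫ ξ : E 2,
        Complex.exp (Complex.I * ((inner ℝ (y - x) ξ : ℝ) : ℂ)) * ((W.chi j ℓ ξ ^ 2 : ℝ) : ℂ) := by
    rw [integral_boxMap (rotAngle j ℓ) ha hb hg, ← mul_assoc, ← Complex.ofReal_mul,
      setIntegral_unitBox]
    · congr 1
      · congr 1; ring
      refine integral_congr_ae (Filter.Eventually.of_forall fun t => ?_)
      simp only [boxWindow, map_mul, ← Complex.exp_conj, Complex.conj_ofReal, Complex.conj_I,
        inner_sub_left]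
      set ξ := boxMap (rotAngle j ℓ) (W.sideOne j) (W.sideTwo j) t
      have h1 : Complex.exp (-Complex.I * (inner ℝ x ξ : ℝ)) *
          Complex.exp (Complex.I * (inner ℝ y ξ : ℝ)) =
          Complex.exp (Complex.I * ((inner ℝ y ξ - inner ℝ x ξ : ℝ) : ℂ)) := by
        rw [← Complex.exp_add]; congr 1; push_cast; ring
      have h2 : Complex.exp (-Complex.I * ((Real.pi * t 0 : ℝ) : ℂ)) *
          Complex.exp (Complex.I * ((Real.pi * t 0 : ℝ) : ℂ)) = 1 := by
        rw [← Complex.exp_add, ← Complex.exp_zero]; congr 1; ring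
      rw [← h1]
      push_cast at h2 ⊢
      linear_combination (Complex.exp (-Complex.I * (inner ℝ x ξ : ℝ)) *
        Complex.exp (Complex.I * (inner ℝ y ξ : ℝ)) * (W.chi j ℓ ξ : ℂ) ^ 2) * h2
    · intro t ht
      refine hW.abs_le_half_of_chi_ne_zero hℓ (fun h => ht ?_)
      rw [boxWindow, h]
      simp
  rw [hint] at hsum2
  have hre := Complex.hasSum_re (hsum2.congr_fun fun k => (hterm k).symm)
  simp only [Complex.ofReal_re, Complex.re_ofReal_mul] at hre
  convert hre using 1
  unfold directionKernel
  congr 1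
  have hI : Integrable fun ξ : E 2 =>
      Complex.exp (Complex.I * ((inner ℝ (y - x) ξ : ℝ) : ℂ)) * ((W.chi j ℓ ξ ^ 2 : ℝ) : ℂ) := by
    refine (hW.integrable_mul_chi_sq hℓ).mono hg.aestronglyMeasurable
      (Filter.Eventually.of_forall fun ξ => ?_)
    rw [norm_mul, mul_comm Complex.I, Complex.norm_exp_ofReal_mul_I, one_mul, Complex.norm_real]
  have := integral_re hI
  simp only [RCLike.re_eq_complex_re] at this
  rw [← this]
  refine integral_congr_ae (Filter.Eventually.of_forall fun ξ => ?_)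
  simp only
  rw [Complex.re_mul_ofReal, mul_comm Complex.I, Complex.exp_ofReal_mul_I_re]

/-! ### The estimator as a convolution kernel -/

/-- The Fourier multiplier of the truncated curvelet expansion. -/
def multiplier (W : CurveletSystem) (j₀ τ : ℕ) (ξ : E 2) : ℝ :=
  ∑ j ∈ Finset.Icc j₀ τ, ∑ ℓ ∈ Finset.range (2 ^ j), W.chi j ℓ ξ ^ 2

/-- The convolution kernel with Fourier transform `m`. -/
def _root_.fourierKernel (m : E 2 → ℝ) (z : E 2) : ℝ :=
  1 / (2 * Real.pi) ^ 2 * ∫ ξ : E 2, Real.cos (inner ℝ z ξ) * m ξ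

theorem _root_.integrable_cos_mul {m : E 2 → ℝ} (hm : Integrable m) (z : E 2) :
    Integrable fun ξ => Real.cos (inner ℝ z ξ) * m ξ := by
  have hc : Continuous fun ξ : E 2 => Real.cos (inner ℝ z ξ) := by fun_prop
  exact hm.bdd_mul (c := 1) hc.aestronglyMeasurable
    (Filter.Eventually.of_forall fun ξ => Real.abs_cos_le_one _)

theorem Admissible.fourierKernel_multiplier (hW : W.Admissible) (j₀ τ : ℕ) (z : E 2) :
    fourierKernel (W.multiplier j₀ τ) z
      = ∑ j ∈ Finset.Icc j₀ τ, ∑ ℓ ∈ Finset.range (2 ^ j), W.directionKernel j ℓ z := by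
  unfold fourierKernel multiplier directionKernel
  simp only [← Finset.mul_sum]
  congr 1
  simp only [Finset.mul_sum]
  have hI : ∀ j, ∀ ℓ ∈ Finset.range (2 ^ j),
      Integrable fun ξ : E 2 => Real.cos (inner ℝ z ξ) * W.chi j ℓ ξ ^ 2 :=
    fun j ℓ hℓ => integrable_cos_mul (hW.integrable_mul_chi_sq (Finset.mem_range.1 hℓ)) z
  rw [integral_finsetSum _ fun j _ => integrable_finsetSum _ (hI j)]
  exact Finset.sum_congr rfl fun j _ => integral_finsetSum _ (hI j)

/-- The coefficients are finite sums over the sample, so the series over k can be summed separately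
for each observation. -/
theorem Admissible.estimator_eq (hW : W.Admissible) (κ : ℝ) (j₀ τ : ℕ) (f : E 2 → ℝ) {n : ℕ}
    (s : Fin n → E 2 × ℝ) (x : E 2) : W.estimator κ j₀ τ f s x =
      κ / n * ∑ i, (f (s i).1 + (s i).2) * fourierKernel (W.multiplier j₀ τ) (x - (s i).1) := by
  have hk : ∀ j, ∀ ℓ < 2 ^ j, ∑' k : ℤ × ℤ, W.coeff κ f s j ℓ k * W.curvelet j ℓ k x
      = κ / n * ∑ i, (f (s i).1 + (s i).2) * W.directionKernel j ℓ (x - (s i).1) := by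
    intro j ℓ hℓ
    refine HasSum.tsum_eq ?_
    have h := (hasSum_sum (s := Finset.univ) fun i (_ : i ∈ Finset.univ) =>
      (hW.hasSum_curvelet hℓ (s i).1 x).mul_left (f (s i).1 + (s i).2)).mul_left (κ / n)
    refine h.congr_fun fun k => ?_
    simp only [coeff]
    rw [mul_assoc, Finset.sum_mul]
    congr 1
    exact Finset.sum_congr rfl fun i _ => by ring
  unfold estimator
  simp only [hW.fourierKernel_multiplier]
  rw [Finset.sum_congr rfl fun j _ => Finset.sum_congr rfl fun ℓ hℓ => hk j ℓ (Finset.mem_range.1 hℓ)]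
  simp only [← Finset.mul_sum]
  congr 1
  simp only [Finset.mul_sum]
  rw [Finset.sum_comm]
  simp_rw [Finset.sum_comm (s := Finset.range _)]

end CurveletSystem

/-! ### Size of the multiplier: weighted upper bound and total mass -/

theorem integral_coord_mul {𝕜 : Type*} [RCLike 𝕜] (f g : ℝ → 𝕜) :
    ∫ ξ : E 2, f (ξ 0) * g (ξ 1) = (∫ t, f t) * ∫ t, g t := by
  rw [← measurePreserving_planeEquiv.integral_comp planeEquiv.measurableEmbedding]
  simp only [planeEquiv_zero, planeEquiv_one]
  exact integral_prod_mul f g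

theorem integrable_coord_mul {𝕜 : Type*} [RCLike 𝕜] {f g : ℝ → 𝕜} (hf : Integrable f)
    (hg : Integrable g) : Integrable fun ξ : E 2 => f (ξ 0) * g (ξ 1) := by
  rw [← measurePreserving_planeEquiv.integrable_comp_emb planeEquiv.measurableEmbedding]
  exact hf.mul_prod hg

namespace CurveletSystem

variable {W : CurveletSystem}

theorem multiplier_nonneg (j₀ τ : ℕ) (ξ : E 2) : 0 ≤ W.multiplier j₀ τ ξ :=
  Finset.sum_nonneg fun _ _ => Finset.sum_nonneg fun _ _ => sq_nonneg _

theorem Admissible.integrable_multiplier (hW : W.Admissible) (j₀ τ : ℕ) :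
    Integrable (W.multiplier j₀ τ) :=
  integrable_finsetSum _ fun _ _ => integrable_finsetSum _ fun _ hℓ =>
    hW.integrable_mul_chi_sq (Finset.mem_range.1 hℓ)

theorem Admissible.sum_chi_sq_eq_zero (hW : W.Admissible) {j : ℕ} {ξ : E 2}
    (hξ : W.radius * 4 ^ j < ‖ξ‖) : ∑ ℓ ∈ Finset.range (2 ^ j), W.chi j ℓ ξ ^ 2 = 0 := by
  refine Finset.sum_eq_zero fun ℓ hℓ => ?_
  by_contra h
  exact absurd (hW.norm_le_of_chi_ne_zero (Finset.mem_range.1 hℓ) fun h0 => h (by simp [h0]))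
    (not_le.2 hξ)

theorem Admissible.norm_le_of_multiplier_ne_zero (hW : W.Admissible) {j₀ τ : ℕ} {ξ : E 2}
    (hξ : W.multiplier j₀ τ ξ ≠ 0) : ‖ξ‖ ≤ W.radius * 4 ^ τ := by
  by_contra! h
  refine hξ (Finset.sum_eq_zero fun j hj => hW.sum_chi_sq_eq_zero (lt_of_le_of_lt ?_ h))
  have := hW.radius_pos
  have := (Finset.mem_Icc.1 hj).2
  gcongr
  norm_num

theorem abs_coord_le_norm (ξ : E 2) (i : Fin 2) : |ξ i| ≤ ‖ξ‖ := by
  simpa using PiLp.norm_apply_le ξ i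

/-- Scale j is bounded by a constant on the strip |ξ₀| ≤ R·4^j and vanishes outside it. The weight
makes the other coordinate integrable with total π, so each scale costs 4^j and the geometric series
at most 2·4^τ. -/
theorem Admissible.exists_integral_multiplier_le (hW : W.Admissible) :
    ∃ B : ℝ, 0 < B ∧ ∀ j₀ τ, ∫ ξ : E 2, W.multiplier j₀ τ ξ * (1 + ξ 1 ^ 2)⁻¹ ≤ B * 4 ^ τ := by
  obtain ⟨B, hB, hle⟩ := hW.exists_bound_sum_chi_sq
  have hp := Real.pi_pos
  have hr := hW.radius_pos
  refine ⟨B * (2 * W.radius) * Real.pi * 2, by positivity, fun j₀ τ => ?_⟩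
  set I : ℕ → Set ℝ := fun j => Set.Icc (-(W.radius * 4 ^ j)) (W.radius * 4 ^ j) with hI
  have hIint : ∀ j, Integrable ((I j).indicator fun _ => B) := fun j =>
    (integrable_indicator_iff measurableSet_Icc).2 (integrableOn_const measure_Icc_lt_top.ne)
  have hint : ∀ j, Integrable fun ξ : E 2 =>
      (I j).indicator (fun _ => B) (ξ 0) * (1 + ξ 1 ^ 2)⁻¹ := fun j =>
    integrable_coord_mul (hIint j) integrable_inv_one_add_sq
  have hval : ∀ j, ∫ ξ : E 2, (I j).indicator (fun _ => B) (ξ 0) * (1 + ξ 1 ^ 2)⁻¹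
      = B * (2 * W.radius) * Real.pi * 4 ^ j := by
    intro j
    rw [integral_coord_mul ((I j).indicator fun _ => B) (fun t => (1 + t ^ 2)⁻¹),
      integral_univ_inv_one_add_sq, integral_indicator measurableSet_Icc, setIntegral_const]
    simp only [Real.volume_real_Icc, smul_eq_mul]
    rw [max_eq_left (by nlinarith [pow_pos (show (0 : ℝ) < 4 by norm_num) j])]
    ring
  calc ∫ ξ : E 2, W.multiplier j₀ τ ξ * (1 + ξ 1 ^ 2)⁻¹
      ≤ ∫ ξ : E 2, ∑ j ∈ Finset.range (τ + 1),
          (I j).indicator (fun _ => B) (ξ 0) * (1 + ξ 1 ^ 2)⁻¹ := by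
        refine integral_mono_of_nonneg (Filter.Eventually.of_forall fun ξ =>
          mul_nonneg (multiplier_nonneg _ _ _) (by positivity))
          (integrable_finsetSum _ fun j _ => hint j) (Filter.Eventually.of_forall fun ξ => ?_)
        simp only
        rw [← Finset.sum_mul]
        refine mul_le_mul_of_nonneg_right ?_ (by positivity)
        refine (Finset.sum_le_sum (g := fun j => (I j).indicator (fun _ => B) (ξ 0))
          fun j _ => ?_).trans (Finset.sum_le_sum_of_subset_of_nonneg (fun j hj => ?_)
            fun j _ _ => Set.indicator_nonneg (fun _ _ => hB.le) _)
        · by_cases h : ξ 0 ∈ I j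
          · rw [Set.indicator_of_mem h]
            exact hle j ξ
          · rw [Set.indicator_of_notMem h, hW.sum_chi_sq_eq_zero]
            by_contra! h'
            exact h (abs_le.1 ((abs_coord_le_norm ξ 0).trans h'))
        · rw [Finset.mem_range]
          have := (Finset.mem_Icc.1 hj).2
          omega
    _ = ∑ j ∈ Finset.range (τ + 1), B * (2 * W.radius) * Real.pi * 4 ^ j := by
        rw [integral_finsetSum _ fun j _ => hint j]
        exact Finset.sum_congr rfl fun j _ => hval j
    _ ≤ B * (2 * W.radius) * Real.pi * 2 * 4 ^ τ := by
        rw [← Finset.mul_sum, mul_assoc _ 2]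
        refine mul_le_mul_of_nonneg_left ?_ (by positivity)
        rw [geom_sum_eq (by norm_num), pow_succ]
        have : (0 : ℝ) < 4 ^ τ := by positivity
        rw [div_le_iff₀ (by norm_num)]
        linarith

/-- The top scale in the first quadrant is enough: there m dominates the dilation of ω(|ξ|)² by 4^τ,
whose planar Jacobian is 16^τ. The conditions j₀ ≤ 1 ≤ τ ensure that scale τ is in the sum and is
not the coarsest one, whose window may be zero. -/
theorem Admissible.exists_le_integral_multiplier (hW : W.Admissible) :
    ∃ c : ℝ, 0 < c ∧ ∀ j₀ ≤ 1, ∀ τ, 1 ≤ τ → c * 16 ^ τ ≤ ∫ ξ, W.multiplier j₀ τ ξ := by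
  obtain ⟨Bω, hBω⟩ := hW.bounded_ω
  obtain ⟨a, b, ha, hab⟩ := hW.support_ω
  set g : E 2 → ℝ := quadrant.indicator fun ξ => W.ω ‖ξ‖ ^ 2 with hg
  have hgm : Measurable g :=
    ((hW.measurable_ω.comp measurable_norm).pow_const 2).indicator measurableSet_quadrant
  have hg0 : ∀ ξ, 0 ≤ g ξ := fun ξ => Set.indicator_nonneg (fun _ _ => sq_nonneg _) _
  have hgi : Integrable g := by
    have hon : IntegrableOn g (Metric.closedBall (0 : E 2) b) := by
      refine Measure.integrableOn_of_bounded measure_closedBall_lt_top.ne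
        hgm.aestronglyMeasurable (M := Bω ^ 2) (Filter.Eventually.of_forall fun ξ => ?_)
      rw [Real.norm_eq_abs, abs_of_nonneg (hg0 ξ)]
      exact Set.indicator_le' (fun ξ _ => sq_le_sq' (abs_le.1 (hBω _)).1 (abs_le.1 (hBω _)).2)
        (fun _ _ => sq_nonneg _) ξ
    refine (integrableOn_iff_integrable_of_support_subset fun ξ hξ => ?_).1 hon
    rw [mem_closedBall_zero_iff]
    by_contra! h
    refine hξ (Set.indicator_apply_eq_zero.2 fun _ => ?_)
    have : W.ω ‖ξ‖ = 0 := by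
      by_contra hne
      exact absurd (hab _ hne).2 (not_le.2 h)
    simp [this]
  have hpos : 0 < ∫ ξ, g ξ := by
    rw [integral_eq_lintegral_of_nonneg_ae (Filter.Eventually.of_forall hg0)
      hgm.aestronglyMeasurable]
    refine ENNReal.toReal_pos ?_ ?_
    · have := hW.setLIntegral_ω_pos
      rw [← lintegral_indicator measurableSet_quadrant] at this
      refine (this.trans_le (lintegral_mono fun ξ => ?_)).ne'
      by_cases h : ξ ∈ quadrant
      · simp [hg, h]
      · simp [hg, h]
    · have := hgi.lintegral_lt_top
      exact this.ne
  refine ⟨∫ ξ, g ξ, hpos, fun j₀ hj₀ τ hτ => ?_⟩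
  have h4 : (0 : ℝ) < 4 ^ τ := by positivity
  have hscale := Measure.integral_comp_smul (volume : Measure (E 2)) g ((4 ^ τ)⁻¹)
  have hfin : Module.finrank ℝ (E 2) = 2 := by simp
  rw [hfin, smul_eq_mul, inv_pow, inv_inv, abs_of_pos (by positivity)] at hscale
  have h16 : ((4 : ℝ) ^ τ) ^ 2 = 16 ^ τ := by rw [← pow_mul, mul_comm, pow_mul]; norm_num
  rw [h16, mul_comm] at hscale
  rw [← hscale]
  refine integral_mono_of_nonneg (Filter.Eventually.of_forall fun ξ => hg0 _)
    (hW.integrable_multiplier j₀ τ) (Filter.Eventually.of_forall fun ξ => ?_)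
  simp only
  by_cases h : ξ ∈ quadrant
  · refine le_trans ?_ (Finset.single_le_sum
      (f := fun j => ∑ ℓ ∈ Finset.range (2 ^ j), W.chi j ℓ ξ ^ 2)
      (fun _ _ => Finset.sum_nonneg fun _ _ => sq_nonneg _)
      (Finset.mem_Icc.2 ⟨hj₀.trans hτ, le_rfl⟩))
    refine le_trans ?_ (hW.le_sum_chi_sq (by omega) h)
    refine (Set.indicator_le_self' (fun _ _ => sq_nonneg _) _).trans (le_of_eq ?_)
    rw [norm_smul, norm_inv, norm_pow, pow_mul]
    norm_num
    rw [inv_mul_eq_div]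
  · have : ((4 : ℝ) ^ τ)⁻¹ • ξ ∉ quadrant := by
      intro h'
      apply h
      have h5 : (0 : ℝ) < (4 ^ τ)⁻¹ := by positivity
      exact ⟨pos_of_mul_pos_right h'.1 h5.le, pos_of_mul_pos_right h'.2 h5.le⟩
    rw [hg, Set.indicator_of_notMem this]
    exact multiplier_nonneg _ _ _

end CurveletSystem

/-! ### Bias–variance for sample means and the regression model -/

theorem lintegral_sq_sampleMean_sub {Ω : Type*} [MeasurableSpace Ω] {μ : Measure Ω}
    [IsProbabilityMeasure μ] {Z : Ω → ℝ} (hZ : MemLp Z 2 μ) {n : ℕ} (hn : 1 ≤ n) (c : ℝ) :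
    ∫⁻ s, ENNReal.ofReal (((n : ℝ)⁻¹ * ∑ i, Z (s i) - c) ^ 2) ∂(Measure.pi fun _ : Fin n => μ)
      = ENNReal.ofReal (Var[Z; μ] / n + (∫ x, Z x ∂μ - c) ^ 2) := by
  have hn0 : (n : ℝ) ≠ 0 := by positivity
  set P : Measure (Fin n → Ω) := Measure.pi fun _ : Fin n => μ with hP
  have hev : ∀ i : Fin n, MeasurePreserving (fun s : Fin n → Ω => s i) P μ := fun i =>
    measurePreserving_eval (fun _ : Fin n => μ) i
  have hZi : ∀ i : Fin n, MemLp (fun s : Fin n → Ω => Z (s i)) 2 P := fun i =>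
    hZ.comp_measurePreserving (hev i)
  set T : (Fin n → Ω) → ℝ := ∑ i, fun s => Z (s i) with hT
  have hTmem : MemLp T 2 P := memLp_finsetSum' _ fun i _ => hZi i
  set S : (Fin n → Ω) → ℝ := fun s => (n : ℝ)⁻¹ * T s with hS
  have hSmem : MemLp S 2 P := hTmem.const_mul _
  have hVarT : Var[T; P] = n * Var[Z; μ] := by
    rw [hT, hP, variance_sum_pi fun _ => hZ]
    simp
  have hVarS : Var[S; P] = Var[Z; μ] / n := by
    rw [hS, variance_const_mul, hVarT]
    field_simp
  have hES : ∫ s, S s ∂P = ∫ x, Z x ∂μ := by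
    rw [hS, integral_const_mul, hT]
    simp only [Finset.sum_apply]
    rw [integral_finsetSum _ fun i _ => (hZi i).integrable (by norm_num)]
    have : ∀ i : Fin n, ∫ s, Z (s i) ∂P = ∫ x, Z x ∂μ := fun i =>
      integral_comp_eval (μ := fun _ : Fin n => μ) hZ.aestronglyMeasurable
    simp only [this, Finset.sum_const, Finset.card_univ, Fintype.card_fin, nsmul_eq_mul]
    rw [inv_mul_cancel_left₀ hn0]
  have hSc : MemLp (fun s => S s - c) 2 P := hSmem.sub (memLp_const c)
  have hmain : ∫ s, (S s - c) ^ 2 ∂P = Var[Z; μ] / n + (∫ x, Z x ∂μ - c) ^ 2 := by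
    have h1 := variance_eq_sub hSc
    rw [variance_sub_const hSmem.aestronglyMeasurable, hVarS,
      integral_sub (hSmem.integrable (by norm_num)) (integrable_const c), hES] at h1
    simp only [integral_const, probReal_univ, one_smul, Pi.pow_apply] at h1
    linarith
  rw [← hmain, ofReal_integral_eq_lintegral_ofReal hSc.integrable_sq
    (Filter.Eventually.of_forall fun _ => sq_nonneg _)]
  refine lintegral_congr fun s => ?_
  simp only [hS, hT, Finset.sum_apply]

theorem integral_sq_gaussianReal (σ : ℝ) :
    ∫ t, t ^ 2 ∂(gaussianReal 0 (σ ^ 2).toNNReal) = σ ^ 2 := by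
  have h := variance_eq_sub (memLp_id_gaussianReal (μ := 0) (v := (σ ^ 2).toNNReal) 2)
  rw [variance_id_gaussianReal] at h
  simp only [id, Pi.pow_apply, integral_id_gaussianReal] at h
  rw [Real.coe_toNNReal _ (sq_nonneg σ)] at h
  linarith

/-- The closed rectangle with corners `a` and `b`. -/
def rectangle (a b : Fin 2 → ℝ) : Set (E 2) := {x | ∀ i, x i ∈ Set.Icc (a i) (b i)}

theorem measurableSet_rectangle (a b : Fin 2 → ℝ) : MeasurableSet (rectangle a b) := by
  have : rectangle a b = ⋂ i, {x : E 2 | x i ∈ Set.Icc (a i) (b i)} := by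
    ext x; simp [rectangle]
  rw [this]
  exact MeasurableSet.iInter fun i => measurable_coord i measurableSet_Icc

theorem volume_rectangle (a b : Fin 2 → ℝ) :
    volume (rectangle a b) = ENNReal.ofReal (b 0 - a 0) * ENNReal.ofReal (b 1 - a 1) := by
  have h := (PiLp.volume_preserving_toLp (Fin 2)).measure_preimage_equiv
    (f := MeasurableEquiv.toLp 2 (Fin 2 → ℝ)) (rectangle a b)
  have h2 : MeasurableEquiv.toLp 2 (Fin 2 → ℝ) ⁻¹' rectangle a b
      = Set.univ.pi fun i => Set.Icc (a i) (b i) := by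
    ext x
    simp only [rectangle, Set.mem_preimage, Set.mem_ofPred_eq, Set.mem_pi, Set.mem_univ,
      true_implies]
    rfl
  rw [← h, h2, volume_pi, Measure.pi_pi, Fin.prod_univ_two, Real.volume_Icc, Real.volume_Icc]

theorem cube_two_eq : cube 2 = rectangle (fun _ => -1) fun _ => 1 := rfl

theorem volume_cube_two : volume (cube 2) = 4 := by
  rw [cube_two_eq, volume_rectangle, ← ENNReal.ofReal_mul (by norm_num)]
  norm_num

theorem measurableSet_cube_two : MeasurableSet (cube 2) := measurableSet_rectangle _ _

namespace CurveletSystem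

instance isProbabilityMeasure_designLaw : IsProbabilityMeasure designLaw :=
  cond_isProbabilityMeasure_of_finite (by rw [volume_cube_two]; norm_num)
    (by rw [volume_cube_two]; norm_num)

theorem designLaw_eq : designLaw = (4 : ENNReal)⁻¹ • volume.restrict (cube 2) := by
  rw [designLaw, ProbabilityTheory.cond, volume_cube_two]

theorem integral_designLaw (f : E 2 → ℝ) : ∫ x, f x ∂designLaw = 1 / 4 * ∫ x in cube 2, f x := by
  rw [designLaw_eq, integral_smul_measure]
  simp

theorem memLp_response {f k : E 2 → ℝ} (hf : Measurable f) (hk : Measurable k) {Bf Bk : ℝ}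
    (hfB : ∀ x, |f x| ≤ Bf) (hkB : ∀ x, |k x| ≤ Bk) (κ : ℝ) (v : NNReal) :
    MemLp (fun p : E 2 × ℝ => κ * ((f p.1 + p.2) * k p.1)) 2 (designLaw.prod (gaussianReal 0 v)) := by
  refine MemLp.const_mul ?_ κ
  have h1 : MemLp (fun p : E 2 × ℝ => f p.1 * k p.1) 2 (designLaw.prod (gaussianReal 0 v)) := by
    refine MemLp.of_bound ((hf.mul hk).comp measurable_fst).aestronglyMeasurable (Bf * Bk)
      (Filter.Eventually.of_forall fun p => ?_)
    rw [Real.norm_eq_abs, abs_mul]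
    exact mul_le_mul (hfB _) (hkB _) (abs_nonneg _) ((abs_nonneg _).trans (hfB p.1))
  have h2 : MemLp (fun p : E 2 × ℝ => p.2) 2 (designLaw.prod (gaussianReal 0 v)) :=
    (memLp_id_gaussianReal (μ := 0) (v := v) 2).comp_snd designLaw
  have h3 : MemLp (fun p : E 2 × ℝ => k p.1 * p.2) 2 (designLaw.prod (gaussianReal 0 v)) := by
    refine MemLp.of_le_mul (c := Bk) h2
      ((hk.comp measurable_fst).mul measurable_snd).aestronglyMeasurable
      (Filter.Eventually.of_forall fun p => ?_)
    rw [norm_mul]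
    exact mul_le_mul_of_nonneg_right (hkB _) (norm_nonneg _)
  refine (h1.add h3).ae_eq (Filter.Eventually.of_forall fun p => ?_)
  simp only [Pi.add_apply]
  ring

theorem integral_response {f k : E 2 → ℝ} (hf : Measurable f) (hk : Measurable k) {Bf Bk : ℝ}
    (hfB : ∀ x, |f x| ≤ Bf) (hkB : ∀ x, |k x| ≤ Bk) (κ : ℝ) (v : NNReal) :
    ∫ p : E 2 × ℝ, κ * ((f p.1 + p.2) * k p.1) ∂(designLaw.prod (gaussianReal 0 v))
      = κ * ∫ x, f x * k x ∂designLaw := by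
  have hfk : Integrable (fun x => f x * k x) designLaw :=
    Integrable.of_bound (hf.mul hk).aestronglyMeasurable (Bf * Bk)
      (Filter.Eventually.of_forall fun p => by
        rw [Real.norm_eq_abs, abs_mul]
        exact mul_le_mul (hfB _) (hkB _) (abs_nonneg _) ((abs_nonneg _).trans (hfB p)))
  have hki : Integrable k designLaw :=
    Integrable.of_bound hk.aestronglyMeasurable Bk (Filter.Eventually.of_forall hkB)
  have hid : Integrable (fun t : ℝ => t) (gaussianReal 0 v) :=
    (memLp_id_gaussianReal (μ := 0) (v := v) 1).integrable le_rfl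
  have e1 : ∀ p : E 2 × ℝ, (f p.1 + p.2) * k p.1 = f p.1 * k p.1 * 1 + k p.1 * p.2 :=
    fun p => by ring
  simp only [e1]
  rw [integral_const_mul, integral_add (hfk.mul_prod (integrable_const (1 : ℝ)))
    (hki.mul_prod hid), integral_prod_mul (fun x => f x * k x) (fun _ : ℝ => (1 : ℝ)),
    integral_prod_mul k (fun t : ℝ => t), integral_id_gaussianReal]
  simp

/-- The noise is centred and independent of the design, so the cross term vanishes and the variance
is κ²(Var(fk) + σ² E k²). The nonnegative design part Var(fk) is dropped. -/
theorem le_variance_response {f k : E 2 → ℝ} (hf : Measurable f) (hk : Measurable k) {Bf Bk : ℝ}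
    (hfB : ∀ x, |f x| ≤ Bf) (hkB : ∀ x, |k x| ≤ Bk) (κ σ : ℝ) :
    κ ^ 2 * σ ^ 2 * ∫ x, k x ^ 2 ∂designLaw ≤
      Var[fun p : E 2 × ℝ => κ * ((f p.1 + p.2) * k p.1);
        designLaw.prod (gaussianReal 0 (σ ^ 2).toNNReal)] := by
  set v := (σ ^ 2).toNNReal with hv
  rw [variance_eq_sub (memLp_response hf hk hfB hkB κ v), integral_response hf hk hfB hkB κ v]
  have hfkm : MemLp (fun x => f x * k x) 2 designLaw :=
    MemLp.of_bound (hf.mul hk).aestronglyMeasurable (Bf * Bk)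
      (Filter.Eventually.of_forall fun p => by
        rw [Real.norm_eq_abs, abs_mul]
        exact mul_le_mul (hfB _) (hkB _) (abs_nonneg _) ((abs_nonneg _).trans (hfB p)))
  have hkm : MemLp k 2 designLaw :=
    MemLp.of_bound hk.aestronglyMeasurable Bk (Filter.Eventually.of_forall hkB)
  have hid : MemLp (fun t : ℝ => t) 2 (gaussianReal 0 v) := memLp_id_gaussianReal 2
  have e1 : ∀ p : E 2 × ℝ, (κ * ((f p.1 + p.2) * k p.1)) ^ 2
      = κ ^ 2 * ((f p.1 * k p.1) ^ 2 * 1 + 2 * (f p.1 * k p.1 * k p.1) * p.2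
        + k p.1 ^ 2 * p.2 ^ 2) := fun p => by ring
  have i1 := hfkm.integrable_sq.mul_prod (integrable_const (μ := gaussianReal 0 v) (1 : ℝ))
  have i2 : Integrable (fun p : E 2 × ℝ => 2 * (f p.1 * k p.1 * k p.1) * p.2)
      (designLaw.prod (gaussianReal 0 v)) := ((hfkm.integrable_mul hkm).const_mul 2).mul_prod (hid.integrable (by norm_num))
  have i3 := hkm.integrable_sq.mul_prod hid.integrable_sq
  have i12 : Integrable (fun p : E 2 × ℝ => (f p.1 * k p.1) ^ 2 * 1 +
      2 * (f p.1 * k p.1 * k p.1) * p.2) (designLaw.prod (gaussianReal 0 v)) := i1.add i2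
  simp only [Pi.pow_apply, e1]
  rw [integral_const_mul, integral_add i12 i3, integral_add i1 i2,
    integral_prod_mul (fun x => (f x * k x) ^ 2) (fun _ : ℝ => (1 : ℝ)),
    integral_prod_mul (fun x => 2 * (f x * k x * k x)) (fun t : ℝ => t),
    integral_prod_mul (fun x => k x ^ 2) (fun t : ℝ => t ^ 2), integral_id_gaussianReal, hv,
    integral_sq_gaussianReal]
  have hvar := variance_nonneg (fun x => f x * k x) designLaw
  rw [variance_eq_sub hfkm] at hvar
  simp only [Pi.pow_apply] at hvar
  simp only [integral_const, probReal_univ, smul_eq_mul, mul_one, mul_zero, add_zero]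
  nlinarith [mul_nonneg (sq_nonneg κ) hvar]

end CurveletSystem

/-! ### Pointwise kernel bounds and the exact risk formula -/

section Kernel

variable {m : E 2 → ℝ}

theorem abs_fourierKernel_le (hm0 : ∀ ξ, 0 ≤ m ξ) (hm : Integrable m) (z : E 2) :
    |fourierKernel m z| ≤ 1 / (2 * Real.pi) ^ 2 * ∫ ξ, m ξ := by
  unfold fourierKernel
  rw [abs_mul, abs_of_nonneg (by positivity)]
  refine mul_le_mul_of_nonneg_left ?_ (by positivity)
  refine norm_integral_le_of_norm_le (f := fun ξ : E 2 => Real.cos (inner ℝ z ξ) * m ξ) hm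
    (Filter.Eventually.of_forall fun ξ => ?_)
  rw [Real.norm_eq_abs, abs_mul, abs_of_nonneg (hm0 ξ)]
  exact mul_le_of_le_one_left (hm0 ξ) (Real.abs_cos_le_one _)

theorem continuous_fourierKernel (hm0 : ∀ ξ, 0 ≤ m ξ) (hm : Integrable m) :
    Continuous (fourierKernel m) := by
  unfold fourierKernel
  refine continuous_const.mul (continuous_of_dominated (bound := m)
    (fun z => (integrable_cos_mul hm z).aestronglyMeasurable)
    (fun z => Filter.Eventually.of_forall fun ξ => ?_) hm
    (Filter.Eventually.of_forall fun ξ => by fun_prop))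
  rw [Real.norm_eq_abs, abs_mul, abs_of_nonneg (hm0 ξ)]
  exact mul_le_of_le_one_left (hm0 ξ) (Real.abs_cos_le_one _)

/-- On the support of m the phase is at most 1 in absolute value, where cos ≥ 1/2: no cancellation
takes place near the origin. -/
theorem le_fourierKernel (hm0 : ∀ ξ, 0 ≤ m ξ) (hm : Integrable m) {R : ℝ}
    (hR : ∀ ξ, m ξ ≠ 0 → ‖ξ‖ ≤ R) {z : E 2} (hz : ‖z‖ * R ≤ 1) :
    1 / (2 * Real.pi) ^ 2 * (1 / 2 * ∫ ξ, m ξ) ≤ fourierKernel m z := by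
  unfold fourierKernel
  refine mul_le_mul_of_nonneg_left ?_ (by positivity)
  rw [← integral_const_mul]
  refine integral_mono (hm.const_mul _) (integrable_cos_mul hm z) fun ξ => ?_
  simp only
  by_cases h : m ξ = 0
  · simp [h]
  refine mul_le_mul_of_nonneg_right ?_ (hm0 ξ)
  have h1 : |inner ℝ z ξ| ≤ 1 := (abs_real_inner_le_norm z ξ).trans
    ((mul_le_mul_of_nonneg_left (hR ξ h) (norm_nonneg z)).trans hz)
  have h2 := Real.one_sub_sq_div_two_le_cos (x := inner ℝ z ξ)
  have h3 := (sq_le_one_iff_abs_le_one _).2 h1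
  linarith

end Kernel

namespace CurveletSystem

variable {W : CurveletSystem}

theorem Admissible.measurable_kernel (hW : W.Admissible) (j₀ τ : ℕ) :
    Measurable (fourierKernel (W.multiplier j₀ τ)) :=
  (continuous_fourierKernel (multiplier_nonneg j₀ τ) (hW.integrable_multiplier j₀ τ)).measurable

/-- By Tonelli x can be fixed first; the estimator at x is then the sample mean of i.i.d.
square-integrable variables. -/
theorem Admissible.risk_eq (hW : W.Admissible) (κ σ : ℝ) (j₀ τ : ℕ) {n : ℕ} (hn : 1 ≤ n)
    {f : E 2 → ℝ} (hf : Measurable f) {Bf : ℝ} (hfB : ∀ x, |f x| ≤ Bf) :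
    W.risk κ j₀ τ σ n f = ∫⁻ x, ENNReal.ofReal (
      Var[fun p : E 2 × ℝ => κ * ((f p.1 + p.2) * fourierKernel (W.multiplier j₀ τ) (x - p.1));
        designLaw.prod (gaussianReal 0 (σ ^ 2).toNNReal)] / n +
      (κ * ∫ y, f y * fourierKernel (W.multiplier j₀ τ) (x - y) ∂designLaw - f x) ^ 2)
      ∂designLaw := by
  set K := fourierKernel (W.multiplier j₀ τ) with hK
  have hKm : Measurable K := hW.measurable_kernel j₀ τ
  have hKB : ∀ z, |K z| ≤ _ := abs_fourierKernel_le (multiplier_nonneg j₀ τ)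
    (hW.integrable_multiplier j₀ τ)
  unfold risk
  simp only [hW.estimator_eq, ← hK]
  unfold sampleLaw
  rw [lintegral_lintegral_swap]
  · refine lintegral_congr fun x => ?_
    have hkm : Measurable fun y => K (x - y) := hKm.comp (measurable_const.sub measurable_id)
    rw [← integral_response hf hkm hfB (fun y => hKB (x - y)) κ (σ ^ 2).toNNReal,
      ← lintegral_sq_sampleMean_sub
        (memLp_response hf hkm hfB (fun y => hKB (x - y)) κ (σ ^ 2).toNNReal) hn]
    refine lintegral_congr fun s => ?_
    congr 3
    rw [Finset.mul_sum, Finset.mul_sum]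
    exact Finset.sum_congr rfl fun i _ => by ring
  · refine Measurable.aemeasurable ?_
    refine ENNReal.measurable_ofReal.comp (Measurable.pow_const ?_ 2)
    refine ((Finset.measurable_fun_sum _ fun i _ => ?_).const_mul _).sub (hf.comp measurable_snd)
    have hsi : Measurable fun a : (Fin n → E 2 × ℝ) × E 2 => a.1 i :=
      (measurable_pi_apply i).comp measurable_fst
    exact ((hf.comp hsi.fst).add hsi.snd).mul (hKm.comp (measurable_snd.sub hsi.fst))

theorem Admissible.bias_le_risk (hW : W.Admissible) (κ σ : ℝ) (j₀ τ : ℕ) {n : ℕ} (hn : 1 ≤ n)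
    {f : E 2 → ℝ} (hf : Measurable f) {Bf : ℝ} (hfB : ∀ x, |f x| ≤ Bf) :
    ∫⁻ x, ENNReal.ofReal
      ((κ * ∫ y, f y * fourierKernel (W.multiplier j₀ τ) (x - y) ∂designLaw - f x) ^ 2) ∂designLaw
      ≤ W.risk κ j₀ τ σ n f := by
  rw [hW.risk_eq κ σ j₀ τ hn hf hfB]
  refine lintegral_mono fun x => ENNReal.ofReal_le_ofReal ?_
  exact le_add_of_nonneg_left (div_nonneg (variance_nonneg _ _) (Nat.cast_nonneg _))

theorem Admissible.noise_le_risk (hW : W.Admissible) (κ σ : ℝ) (j₀ τ : ℕ) {n : ℕ} (hn : 1 ≤ n)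
    {f : E 2 → ℝ} (hf : Measurable f) {Bf : ℝ} (hfB : ∀ x, |f x| ≤ Bf) :
    ∫⁻ x, ENNReal.ofReal (κ ^ 2 * σ ^ 2 *
      (∫ y, fourierKernel (W.multiplier j₀ τ) (x - y) ^ 2 ∂designLaw) / n) ∂designLaw
      ≤ W.risk κ j₀ τ σ n f := by
  rw [hW.risk_eq κ σ j₀ τ hn hf hfB]
  refine lintegral_mono fun x => ENNReal.ofReal_le_ofReal ?_
  refine le_add_of_le_of_nonneg ?_ (sq_nonneg _)
  refine div_le_div_of_nonneg_right ?_ (Nat.cast_nonneg _)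
  exact le_variance_response hf
    ((hW.measurable_kernel j₀ τ).comp (measurable_const.sub measurable_id)) hfB
    (fun y => abs_fourierKernel_le (multiplier_nonneg j₀ τ) (hW.integrable_multiplier j₀ τ) (x - y))
    κ σ

end CurveletSystem

/-! ### Lower bound for the noise term -/

section Energy

open CurveletSystem

theorem designLaw_rectangle {a b : Fin 2 → ℝ} (hab : rectangle a b ⊆ cube 2) :
    designLaw (rectangle a b)
      = (4 : ENNReal)⁻¹ * (ENNReal.ofReal (b 0 - a 0) * ENNReal.ofReal (b 1 - a 1)) := by
  rw [designLaw_eq, Measure.smul_apply, Measure.restrict_apply (measurableSet_rectangle a b),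
    Set.inter_eq_left.2 hab, volume_rectangle, smul_eq_mul]

/-- For x in the lower left quarter the square x + [0, r]² does not leave the cube, so no boundary
effect reduces its mass r²/4. Its points are within 2r of x by the ℓ¹ bound on the norm. -/
theorem le_integral_sq_of_le_near_zero {K : E 2 → ℝ} (hK : Continuous K) {B : ℝ}
    (hB : ∀ z, |K z| ≤ B) {k r : ℝ} (hk : 0 ≤ k) (hr0 : 0 ≤ r) (hr1 : r ≤ 1)
    (hkK : ∀ z : E 2, ‖z‖ ≤ 2 * r → k ≤ K z) {x : E 2} (hx : ∀ i, x i ∈ Set.Icc (-1 : ℝ) 0) :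
    k ^ 2 * r ^ 2 / 4 ≤ ∫ y, K (x - y) ^ 2 ∂designLaw := by
  have hsub : rectangle (fun i => x i) (fun i => x i + r) ⊆ cube 2 := fun y hy i => by
    obtain ⟨h1, h2⟩ := hy i
    obtain ⟨h3, h4⟩ := hx i
    constructor <;> linarith
  set S := rectangle (fun i => x i) (fun i => x i + r) with hS
  have hP : designLaw.real S = r ^ 2 / 4 := by
    rw [Measure.real, designLaw_rectangle hsub]
    simp only [add_sub_cancel_left, ENNReal.toReal_mul, ENNReal.toReal_ofReal hr0,
      ENNReal.toReal_inv]
    norm_num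
    ring
  have hint : Integrable (fun y => K (x - y) ^ 2) designLaw := by
    refine Integrable.of_bound (Continuous.aestronglyMeasurable (by fun_prop)) (B ^ 2)
      (Filter.Eventually.of_forall fun y => ?_)
    rw [Real.norm_eq_abs, abs_pow]
    exact pow_le_pow_left₀ (abs_nonneg _) (hB _) 2
  calc k ^ 2 * r ^ 2 / 4 = ∫ y, S.indicator (fun _ => k ^ 2) y ∂designLaw := by
        rw [integral_indicator (measurableSet_rectangle _ _), setIntegral_const, hP, smul_eq_mul]
        ring
    _ ≤ _ := by
        refine integral_mono
          ((integrable_const _).indicator (measurableSet_rectangle _ _)) hint fun y => ?_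
        refine Set.indicator_apply_le' (fun hy => ?_) fun _ => sq_nonneg _
        refine pow_le_pow_left₀ hk (hkK _ ((norm_le_add_abs _).trans ?_)) 2
        have h0 := hy 0
        have h1 := hy 1
        simp only [PiLp.sub_apply]
        rw [abs_sub_comm, abs_sub_comm (x 1), abs_of_nonneg (by linarith [h0.1]),
          abs_of_nonneg (by linarith [h1.1])]
        linarith [h0.2, h1.2]

theorem designLaw_negative_square :
    designLaw (rectangle (fun _ => -1) fun _ => 0) = ENNReal.ofReal (1 / 4) := by
  rw [designLaw_rectangle fun x hx i => ⟨(hx i).1, (hx i).2.trans zero_le_one⟩]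
  simp only [zero_sub, neg_neg, ENNReal.ofReal_one, mul_one]
  rw [one_div, ENNReal.ofReal_inv_of_pos (by norm_num)]
  norm_num

theorem le_lintegral_noise {K : E 2 → ℝ} (hK : Continuous K) {B : ℝ}
    (hB : ∀ z, |K z| ≤ B) {k r C : ℝ} (hk : 0 ≤ k) (hr0 : 0 ≤ r) (hr1 : r ≤ 1) (hC : 0 ≤ C)
    (hkK : ∀ z : E 2, ‖z‖ ≤ 2 * r → k ≤ K z) (n : ℕ) :
    ENNReal.ofReal (C * (k ^ 2 * r ^ 2) / n / 16) ≤
      ∫⁻ x, ENNReal.ofReal (C * (∫ y, K (x - y) ^ 2 ∂designLaw) / n) ∂designLaw := by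
  set S := rectangle (fun _ => -1) fun _ => 0 with hS
  calc ENNReal.ofReal (C * (k ^ 2 * r ^ 2) / n / 16)
      = ∫⁻ _x in S, ENNReal.ofReal (C * (k ^ 2 * r ^ 2 / 4) / n) ∂designLaw := by
        rw [setLIntegral_const, hS, designLaw_negative_square, ← ENNReal.ofReal_mul (by positivity)]
        congr 1
        ring
    _ ≤ ∫⁻ x in S, ENNReal.ofReal (C * (∫ y, K (x - y) ^ 2 ∂designLaw) / n) ∂designLaw := by
        refine setLIntegral_mono' (measurableSet_rectangle _ _) fun x hx =>
          ENNReal.ofReal_le_ofReal ?_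
        have := le_integral_sq_of_le_near_zero hK hB hk hr0 hr1 hkK hx
        gcongr
    _ ≤ _ := setLIntegral_le_lintegral _ _

end Energy

namespace CurveletSystem

variable {W : CurveletSystem}

theorem Admissible.exists_noise_le_risk (hW : W.Admissible) {κ σ : ℝ} (hκ : 0 < κ) (hσ : 0 < σ) :
    ∃ c : ℝ, 0 < c ∧ ∀ j₀ ≤ 1, ∀ τ, 1 ≤ τ → ∀ n : ℕ, 1 ≤ n → ∀ f : E 2 → ℝ, Measurable f →
      ∀ Bf : ℝ, (∀ x, |f x| ≤ Bf) →
        ENNReal.ofReal (c * 16 ^ τ / n) ≤ W.risk κ j₀ τ σ n f := by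
  obtain ⟨c₀, hc₀, hle⟩ := hW.exists_le_integral_multiplier
  have hR := hW.radius_pos
  have hp := Real.pi_pos
  set c₁ : ℝ := 1 / (2 * Real.pi) ^ 2 * (1 / 2 * c₀) with hc₁
  have hc₁pos : 0 < c₁ := by positivity
  -- Radius 2ρ/4^τ times the bandwidth R·4^τ must be at most 1; the added 1 also gives ρ ≤ 1, which
  -- keeps the square inside the cube.
  set ρ : ℝ := 1 / (2 * W.radius + 1) with hρ
  have hρ0 : 0 < ρ := by positivity
  have hρ1 : ρ ≤ 1 := by rw [hρ, div_le_one (by positivity)]; linarith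
  have hρR : 2 * ρ * W.radius ≤ 1 := by
    rw [hρ]
    field_simp
    linarith
  refine ⟨κ ^ 2 * σ ^ 2 * (c₁ ^ 2 * ρ ^ 2) / 16, by positivity,
    fun j₀ hj₀ τ hτ n hn f hf Bf hfB => ?_⟩
  have hm0 := multiplier_nonneg (W := W) j₀ τ
  have hmi := hW.integrable_multiplier j₀ τ
  have h4 : (1 : ℝ) ≤ 4 ^ τ := one_le_pow₀ (by norm_num)
  have h4' : (0 : ℝ) < 4 ^ τ := by linarith
  have hr1 : ρ / 4 ^ τ ≤ 1 := (div_le_one h4').2 (hρ1.trans h4)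
  have hkK : ∀ z : E 2, ‖z‖ ≤ 2 * (ρ / 4 ^ τ) →
      c₁ * 16 ^ τ ≤ fourierKernel (W.multiplier j₀ τ) z := by
    intro z hz
    refine le_trans ?_ (le_fourierKernel hm0 hmi
      (fun ξ hξ => hW.norm_le_of_multiplier_ne_zero hξ) (z := z) ?_)
    · have := hle j₀ hj₀ τ hτ
      rw [hc₁, mul_assoc, mul_assoc]
      gcongr
    · calc ‖z‖ * (W.radius * 4 ^ τ) ≤ 2 * (ρ / 4 ^ τ) * (W.radius * 4 ^ τ) := by gcongr
        _ = 2 * ρ * W.radius := by field_simp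
        _ ≤ 1 := hρR
  refine le_trans ?_ (hW.noise_le_risk κ σ j₀ τ hn hf hfB)
  refine le_trans (ENNReal.ofReal_le_ofReal (le_of_eq ?_))
    (le_lintegral_noise (continuous_fourierKernel hm0 hmi) (abs_fourierKernel_le hm0 hmi)
      (by positivity) (by positivity) hr1 (by positivity) hkK n)
  have h16 : (16 : ℝ) ^ τ = 4 ^ τ * 4 ^ τ := by rw [← mul_pow]; norm_num
  rw [h16]
  field_simp

end CurveletSystem

/-! ### Lower bound for the bias: testing across the edge -/

/-- The Fourier integral of the indicator function of `[0, 1]`. -/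
def unitTransform (t : ℝ) : ℂ :=
  ∫ x, ((Set.Icc (0 : ℝ) 1).indicator 1 x : ℂ) * Complex.exp (Complex.I * ((x * t : ℝ) : ℂ))

theorem unitTransform_eq (t : ℝ) :
    unitTransform t = ∫ x in (0 : ℝ)..1, Complex.exp (Complex.I * t * x) := by
  rw [intervalIntegral.integral_of_le zero_le_one, ← integral_Icc_eq_integral_Ioc,
    ← integral_indicator measurableSet_Icc]
  refine integral_congr_ae (Filter.Eventually.of_forall fun x => ?_)
  by_cases hx : x ∈ Set.Icc (0 : ℝ) 1
  · simp only [Set.indicator_of_mem hx, Pi.one_apply, one_mul]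
    congr 1
    push_cast
    ring
  · simp only [Set.indicator_of_notMem hx, zero_mul]

theorem norm_unitTransform_le (t : ℝ) : ‖unitTransform t‖ ≤ 1 := by
  rw [unitTransform_eq]
  refine (intervalIntegral.norm_integral_le_of_norm_le_const (C := 1) fun x _ => ?_).trans
    (by norm_num)
  rw [show Complex.I * t * x = ((t * x : ℝ) : ℂ) * Complex.I by push_cast; ring,
    Complex.norm_exp_ofReal_mul_I]

theorem abs_mul_norm_unitTransform_le (t : ℝ) : |t| * ‖unitTransform t‖ ≤ 2 := by
  by_cases ht : t = 0
  · simp [ht]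
  have hc : Complex.I * t ≠ 0 := mul_ne_zero Complex.I_ne_zero (Complex.ofReal_ne_zero.2 ht)
  rw [unitTransform_eq, integral_exp_mul_complex hc, norm_div, norm_mul, Complex.norm_I, one_mul,
    Complex.norm_real, Real.norm_eq_abs, mul_div_cancel₀ _ (abs_ne_zero.2 ht)]
  refine (norm_sub_le _ _).trans ?_
  rw [show Complex.I * t * ((1 : ℝ) : ℂ) = (t : ℂ) * Complex.I by push_cast; ring,
    Complex.norm_exp_ofReal_mul_I]
  norm_num

/-- The Haar function on `[-s, s]`. -/
def haar (s : ℝ) (x : ℝ) : ℝ :=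
  (Set.Ioc 0 s).indicator 1 x - (Set.Ico (-s) 0).indicator 1 x

/-- The Haar function has mean zero: pairing x with -x leaves e(x) - e(-x), of size at most 2s|t|,
on an interval of length s. The growth in |t| is compensated later by the 1/|t| decay of
`unitTransform`. -/
theorem norm_haarTransform_le {s : ℝ} (hs : 0 ≤ s) (t : ℝ) :
    ‖∫ x, (haar s x : ℂ) * Complex.exp (Complex.I * ((x * t : ℝ) : ℂ))‖ ≤ 2 * s ^ 2 * |t| := by
  set e : ℝ → ℂ := fun x => Complex.exp (Complex.I * ((x * t : ℝ) : ℂ)) with he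
  have hec : Continuous e := by rw [he]; fun_prop
  have h1 : ∀ x, (haar s x : ℂ) * e x = (Set.Ioc 0 s).indicator e x - (Set.Ico (-s) 0).indicator e x := by
    intro x
    unfold haar
    by_cases hx : x ∈ Set.Ioc 0 s <;> by_cases hx' : x ∈ Set.Ico (-s) 0 <;> simp [hx, hx']
  rw [show (fun x => (haar s x : ℂ) * Complex.exp (Complex.I * ((x * t : ℝ) : ℂ))) =
    fun x => (Set.Ioc 0 s).indicator e x - (Set.Ico (-s) 0).indicator e x from funext h1]
  have i1 : Integrable ((Set.Ioc 0 s).indicator e) :=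
    (integrable_indicator_iff measurableSet_Ioc).2
      (hec.integrableOn_Icc.mono_set Set.Ioc_subset_Icc_self)
  have i2 : Integrable ((Set.Ico (-s) 0).indicator e) :=
    (integrable_indicator_iff measurableSet_Ico).2
      (hec.integrableOn_Icc.mono_set Set.Ico_subset_Icc_self)
  rw [integral_sub i1 i2, integral_indicator measurableSet_Ioc, integral_indicator measurableSet_Ico,
    integral_Ico_eq_integral_Ioc, ← intervalIntegral.integral_of_le hs,
    ← intervalIntegral.integral_of_le (by linarith : -s ≤ 0)]
  have h2 : ∫ x in (-s)..0, e x = ∫ x in (0 : ℝ)..s, e (-x) := by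
    rw [intervalIntegral.integral_comp_neg, neg_zero]
  have hec' : Continuous fun x => e (-x) := hec.comp continuous_neg
  rw [h2, ← intervalIntegral.integral_sub (hec.intervalIntegrable _ _)
    (hec'.intervalIntegrable _ _)]
  refine (intervalIntegral.norm_integral_le_of_norm_le_const (C := 2 * (s * |t|))
    fun x hx => ?_).trans (le_of_eq ?_)
  · rw [Set.uIoc_of_le hs] at hx
    have hb : ∀ u : ℝ, ‖e u - 1‖ ≤ |u| * |t| := fun u => by
      have := Real.norm_exp_I_mul_ofReal_sub_one_le (x := u * t)
      rwa [Real.norm_eq_abs, abs_mul] at this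
    have hx' : |x| * |t| ≤ s * |t| := by
      rw [abs_of_pos hx.1]
      exact mul_le_mul_of_nonneg_right hx.2 (abs_nonneg _)
    calc ‖e x - e (-x)‖ = ‖(e x - 1) - (e (-x) - 1)‖ := by congr 1; ring
      _ ≤ |x| * |t| + |-x| * |t| := (norm_sub_le _ _).trans (add_le_add (hb _) (hb _))
      _ ≤ 2 * (s * |t|) := by rw [abs_neg]; linarith
  · rw [sub_zero, abs_of_nonneg hs]
    ring

/-- The indicator function of `[0, 1]²`. -/
def unitSquare (x : E 2) : ℝ :=
  (Set.Icc (0 : ℝ) 1).indicator 1 (x 0) * (Set.Icc (0 : ℝ) 1).indicator 1 (x 1)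

/-- A test function that oscillates across the segment `{0} × [0, 1]`. -/
def edgeTest (s : ℝ) (x : E 2) : ℝ := haar s (x 0) * (Set.Icc (0 : ℝ) 1).indicator 1 (x 1)

theorem inner_eq (x ξ : E 2) : inner ℝ x ξ = x 0 * ξ 0 + x 1 * ξ 1 := by
  simp [PiLp.inner_apply, Fin.sum_univ_two]
  ring

theorem integrable_unitIndicator : Integrable ((Set.Icc (0 : ℝ) 1).indicator (1 : ℝ → ℝ)) :=
  (integrable_indicator_iff measurableSet_Icc).2 (integrableOn_const measure_Icc_lt_top.ne)

theorem integrable_haar (s : ℝ) : Integrable (haar s) :=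
  ((integrable_indicator_iff measurableSet_Ioc).2 (integrableOn_const measure_Ioc_lt_top.ne)).sub
    ((integrable_indicator_iff measurableSet_Ico).2 (integrableOn_const measure_Ico_lt_top.ne))

theorem integrable_unitSquare : Integrable unitSquare :=
  integrable_coord_mul integrable_unitIndicator integrable_unitIndicator

theorem integrable_edgeTest (s : ℝ) : Integrable (edgeTest s) :=
  integrable_coord_mul (integrable_haar s) integrable_unitIndicator

theorem exp_inner_eq (x ξ : E 2) : Complex.exp (Complex.I * ((inner ℝ x ξ : ℝ) : ℂ)) =
    Complex.exp (Complex.I * ((x 0 * ξ 0 : ℝ) : ℂ)) *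
      Complex.exp (Complex.I * ((x 1 * ξ 1 : ℝ) : ℂ)) := by
  rw [← Complex.exp_add, inner_eq]
  congr 1
  push_cast
  ring

theorem ofReal_unitIndicator (t : ℝ) : (((Set.Icc (0 : ℝ) 1).indicator 1 t : ℝ) : ℂ)
    = (Set.Icc (0 : ℝ) 1).indicator 1 t := by
  by_cases h : t ∈ Set.Icc (0 : ℝ) 1 <;> simp [h]

theorem integral_unitSquare_mul_exp (ξ : E 2) :
    ∫ y : E 2, (unitSquare y : ℂ) * Complex.exp (Complex.I * ((inner ℝ y ξ : ℝ) : ℂ))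
      = unitTransform (ξ 0) * unitTransform (ξ 1) := by
  unfold unitTransform
  rw [← integral_coord_mul (fun t => ((Set.Icc (0 : ℝ) 1).indicator 1 t : ℂ) *
      Complex.exp (Complex.I * ((t * ξ 0 : ℝ) : ℂ)))
    (fun t => ((Set.Icc (0 : ℝ) 1).indicator 1 t : ℂ) *
      Complex.exp (Complex.I * ((t * ξ 1 : ℝ) : ℂ)))]
  refine integral_congr_ae (Filter.Eventually.of_forall fun y => ?_)
  simp only [unitSquare, exp_inner_eq, Complex.ofReal_mul, ofReal_unitIndicator]
  ring

theorem integral_edgeTest_mul_exp (s : ℝ) (ξ : E 2) :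
    ∫ x : E 2, (edgeTest s x : ℂ) * Complex.exp (Complex.I * ((inner ℝ x ξ : ℝ) : ℂ))
      = (∫ t, (haar s t : ℂ) * Complex.exp (Complex.I * ((t * ξ 0 : ℝ) : ℂ))) *
        unitTransform (ξ 1) := by
  unfold unitTransform
  rw [← integral_coord_mul (fun t => (haar s t : ℂ) *
      Complex.exp (Complex.I * ((t * ξ 0 : ℝ) : ℂ)))
    (fun t => ((Set.Icc (0 : ℝ) 1).indicator 1 t : ℂ) *
      Complex.exp (Complex.I * ((t * ξ 1 : ℝ) : ℂ)))]
  refine integral_congr_ae (Filter.Eventually.of_forall fun y => ?_)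
  simp only [edgeTest, exp_inner_eq, Complex.ofReal_mul, ofReal_unitIndicator]
  ring

theorem measurable_exp_inner_left (ξ : E 2) :
    Measurable fun x : E 2 => Complex.exp (Complex.I * ((inner ℝ x ξ : ℝ) : ℂ)) := by
  have : Continuous fun x : E 2 => Complex.exp (Complex.I * ((inner ℝ x ξ : ℝ) : ℂ)) := by
    fun_prop
  exact this.measurable

theorem norm_exp_I_mul_ofReal (t : ℝ) : ‖Complex.exp (Complex.I * (t : ℂ))‖ = 1 := by
  rw [mul_comm, Complex.norm_exp_ofReal_mul_I]

/-- The integral is the real part of a product of one-dimensional transforms. Across the edge,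
2s²|ξ₀| meets a decay 2/|ξ₀|, giving 4s². Along the edge, two transforms bounded by both 1 and
2/|ξ₁| give 5/(1 + ξ₁²). -/
theorem abs_integral_edgeTest_cos_le {s : ℝ} (hs : 0 ≤ s) (ξ : E 2) :
    |∫ p : E 2 × E 2, edgeTest s p.1 * unitSquare p.2 * Real.cos (inner ℝ (p.1 - p.2) ξ)|
      ≤ 20 * s ^ 2 * (1 + ξ 1 ^ 2)⁻¹ := by
  set Φ : E 2 → ℂ := fun x => (edgeTest s x : ℂ) * Complex.exp (Complex.I * ((inner ℝ x ξ : ℝ) : ℂ))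
    with hΦ
  set Ψ : E 2 → ℂ := fun x => (unitSquare x : ℂ) *
    Complex.exp (Complex.I * ((inner ℝ x (-ξ) : ℝ) : ℂ)) with hΨ
  have hΦi : Integrable Φ :=
    (integrable_edgeTest s).ofReal.mul_bdd (c := 1) (measurable_exp_inner_left ξ).aestronglyMeasurable
      (Filter.Eventually.of_forall fun x => (norm_exp_I_mul_ofReal _).le)
  have hΨi : Integrable Ψ :=
    integrable_unitSquare.ofReal.mul_bdd (c := 1) (measurable_exp_inner_left (-ξ)).aestronglyMeasurable
      (Filter.Eventually.of_forall fun x => (norm_exp_I_mul_ofReal _).le)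
  have hre : ∫ p : E 2 × E 2, edgeTest s p.1 * unitSquare p.2 * Real.cos (inner ℝ (p.1 - p.2) ξ)
      = (∫ p : E 2 × E 2, Φ p.1 * Ψ p.2).re := by
    have := integral_re (hΦi.mul_prod hΨi)
    simp only [RCLike.re_eq_complex_re] at this
    refine Eq.trans ?_ this
    refine integral_congr_ae (Filter.Eventually.of_forall fun p => ?_)
    have : Φ p.1 * Ψ p.2 = ((edgeTest s p.1 * unitSquare p.2 : ℝ) : ℂ) *
        Complex.exp (((inner ℝ (p.1 - p.2) ξ : ℝ) : ℂ) * Complex.I) := by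
      simp only [hΦ, hΨ]
      rw [inner_sub_left, inner_neg_right, mul_mul_mul_comm, ← Complex.exp_add, ← Complex.ofReal_mul]
      congr 2
      push_cast
      ring
    simp only [this, Complex.re_ofReal_mul, Complex.exp_ofReal_mul_I_re]
  rw [hre]
  refine (Complex.abs_re_le_norm _).trans ?_
  rw [Measure.volume_eq_prod, integral_prod_mul Φ Ψ, hΦ, hΨ, integral_edgeTest_mul_exp, integral_unitSquare_mul_exp]
  simp only [PiLp.neg_apply, norm_mul]
  have h1 := norm_haarTransform_le hs (ξ 0)
  set A := ‖∫ t, (haar s t : ℂ) * Complex.exp (Complex.I * ((t * ξ 0 : ℝ) : ℂ))‖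
  have h2 := norm_unitTransform_le (ξ 1)
  have h3 := norm_unitTransform_le (-ξ 1)
  have h4 := abs_mul_norm_unitTransform_le (ξ 1)
  have h5 := abs_mul_norm_unitTransform_le (-ξ 1)
  have h6 := abs_mul_norm_unitTransform_le (-ξ 0)
  rw [abs_neg] at h5 h6
  set u := ‖unitTransform (ξ 1)‖
  set v := ‖unitTransform (-ξ 1)‖
  set w := ‖unitTransform (-ξ 0)‖
  have hu : 0 ≤ u := norm_nonneg _
  have hv : 0 ≤ v := norm_nonneg _
  have hw : 0 ≤ w := norm_nonneg _
  have huv : u * v * (1 + ξ 1 ^ 2) ≤ 5 := by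
    have e1 : u * v ≤ 1 := mul_le_one₀ h2 hv h3
    have e2 : (|ξ 1| * u) * (|ξ 1| * v) ≤ 2 * 2 := mul_le_mul h4 h5 (by positivity) (by norm_num)
    have e3 : (|ξ 1| * u) * (|ξ 1| * v) = u * v * ξ 1 ^ 2 := by rw [← sq_abs (ξ 1)]; ring
    linarith
  have hAw : A * w ≤ 4 * s ^ 2 := by
    calc A * w ≤ 2 * s ^ 2 * |ξ 0| * w := mul_le_mul_of_nonneg_right h1 hw
      _ = 2 * s ^ 2 * (|ξ 0| * w) := by ring
      _ ≤ 2 * s ^ 2 * 2 := by gcongr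
      _ = 4 * s ^ 2 := by ring
  rw [← div_eq_mul_inv, le_div_iff₀ (by positivity)]
  calc A * u * (w * v) * (1 + ξ 1 ^ 2) = (A * w) * (u * v * (1 + ξ 1 ^ 2)) := by ring
    _ ≤ 4 * s ^ 2 * 5 := by gcongr
    _ = 20 * s ^ 2 := by ring

/-- Fubini moves the frequency integral outside, where the previous bound applies for each ξ; the
factor 20 is absorbed by (2π)². -/
theorem abs_integral_edgeTest_kernel_le {m : E 2 → ℝ} (hm0 : ∀ ξ, 0 ≤ m ξ) (hm : Integrable m)
    {s M : ℝ} (hs : 0 ≤ s) (hM : ∫ ξ : E 2, m ξ * (1 + ξ 1 ^ 2)⁻¹ ≤ M) :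
    |∫ p : E 2 × E 2, edgeTest s p.1 * unitSquare p.2 * fourierKernel m (p.1 - p.2)|
      ≤ s ^ 2 * M := by
  have hprod : Integrable fun p : E 2 × E 2 => edgeTest s p.1 * unitSquare p.2 :=
    (integrable_edgeTest s).mul_prod integrable_unitSquare
  have hH : Integrable (Function.uncurry fun (p : E 2 × E 2) (ξ : E 2) =>
      edgeTest s p.1 * unitSquare p.2 * Real.cos (inner ℝ (p.1 - p.2) ξ) * m ξ)
      ((volume : Measure (E 2 × E 2)).prod volume) := by
    have h1 := (hprod.mul_prod hm).bdd_mul (c := 1)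
      (f := fun q : (E 2 × E 2) × E 2 => Real.cos (inner ℝ (q.1.1 - q.1.2) q.2))
      (Continuous.aestronglyMeasurable (by fun_prop))
      (Filter.Eventually.of_forall fun q => Real.abs_cos_le_one _)
    refine h1.congr (Filter.Eventually.of_forall fun q => ?_)
    simp only [Function.uncurry]
    ring
  have hswap := integral_integral_swap hH
  have hl : ∫ p : E 2 × E 2, edgeTest s p.1 * unitSquare p.2 * fourierKernel m (p.1 - p.2)
      = 1 / (2 * Real.pi) ^ 2 * ∫ ξ, (∫ p : E 2 × E 2, edgeTest s p.1 * unitSquare p.2 *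
        Real.cos (inner ℝ (p.1 - p.2) ξ)) * m ξ := by
    simp only [← integral_mul_const]
    rw [← hswap, ← integral_const_mul]
    refine integral_congr_ae (Filter.Eventually.of_forall fun p => ?_)
    simp only [fourierKernel, mul_assoc, integral_const_mul]
    ring
  rw [hl, abs_mul, abs_of_nonneg (by positivity)]
  have hw : Integrable fun ξ : E 2 => m ξ * (1 + ξ 1 ^ 2)⁻¹ := by
    refine hm.mul_bdd (c := 1) ?_ (Filter.Eventually.of_forall fun ξ => ?_)
    · exact (((measurable_coord 1).pow_const 2).const_add 1).inv.aestronglyMeasurable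
    · rw [Real.norm_eq_abs, abs_of_nonneg (by positivity)]
      exact inv_le_one_of_one_le₀ (by nlinarith [sq_nonneg (ξ 1)])
  have hb : |∫ ξ, (∫ p : E 2 × E 2, edgeTest s p.1 * unitSquare p.2 *
      Real.cos (inner ℝ (p.1 - p.2) ξ)) * m ξ| ≤ 20 * s ^ 2 * M := by
    rw [← Real.norm_eq_abs]
    refine (norm_integral_le_of_norm_le (hw.const_mul (20 * s ^ 2))
      (Filter.Eventually.of_forall fun ξ => ?_)).trans ?_
    · rw [Real.norm_eq_abs, abs_mul, abs_of_nonneg (hm0 ξ)]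
      refine (mul_le_mul_of_nonneg_right (abs_integral_edgeTest_cos_le hs ξ) (hm0 ξ)).trans
        (le_of_eq ?_)
      ring
    · rw [integral_const_mul]
      gcongr
  have hM0 : 0 ≤ M := le_trans (integral_nonneg fun ξ => mul_nonneg (hm0 ξ) (by positivity)) hM
  have hpi : 1 / (2 * Real.pi) ^ 2 ≤ 1 / 20 := by
    have := Real.pi_gt_three
    refine one_div_le_one_div_of_le (by norm_num) (by nlinarith)
  calc 1 / (2 * Real.pi) ^ 2 * |∫ ξ, (∫ p : E 2 × E 2, edgeTest s p.1 * unitSquare p.2 *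
      Real.cos (inner ℝ (p.1 - p.2) ξ)) * m ξ| ≤ 1 / 20 * (20 * s ^ 2 * M) :=
        mul_le_mul hpi hb (abs_nonneg _) (by norm_num)
    _ = s ^ 2 * M := by ring

theorem mem_cube_two {x : E 2} :
    x ∈ cube 2 ↔ x 0 ∈ Set.Icc (-1 : ℝ) 1 ∧ x 1 ∈ Set.Icc (-1 : ℝ) 1 :=
  Fin.forall_fin_two

theorem edgeTest_eq_zero {s : ℝ} (hs : s ≤ 1) {x : E 2} (hx : x ∉ cube 2) : edgeTest s x = 0 := by
  by_contra h
  apply hx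
  have h0 : haar s (x 0) ≠ 0 := left_ne_zero_of_mul h
  have h1 : (Set.Icc (0 : ℝ) 1).indicator (1 : ℝ → ℝ) (x 1) ≠ 0 := right_ne_zero_of_mul h
  have h1' := Set.mem_of_indicator_ne_zero h1
  refine mem_cube_two.2 ⟨?_, ?_⟩
  · unfold haar at h0
    by_cases ha : x 0 ∈ Set.Ioc 0 s
    · exact ⟨by linarith [ha.1], ha.2.trans hs⟩
    by_cases hb : x 0 ∈ Set.Ico (-s) 0
    · exact ⟨by linarith [hb.1], by linarith [hb.2]⟩
    simp [ha, hb] at h0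
  · exact ⟨by linarith [h1'.1], h1'.2⟩

theorem indicator_cube_stepProduct (x : E 2) : (cube 2).indicator stepProduct x = unitSquare x := by
  unfold unitSquare stepProduct
  by_cases hx : x ∈ cube 2
  · have h0 := hx 0
    have h1 := hx 1
    rw [Set.indicator_of_mem hx]
    by_cases a : 0 ≤ x 0 <;> by_cases b : 0 ≤ x 1 <;>
      simp [a, b, h0.2, h1.2]
  · rw [Set.indicator_of_notMem hx]
    by_contra h
    have h0 := Set.mem_of_indicator_ne_zero (left_ne_zero_of_mul (Ne.symm h))
    have h1 := Set.mem_of_indicator_ne_zero (right_ne_zero_of_mul (Ne.symm h))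
    apply hx
    refine mem_cube_two.2 ⟨?_, ?_⟩
    · exact ⟨by linarith [h0.1], h0.2⟩
    · exact ⟨by linarith [h1.1], h1.2⟩

theorem stepProduct_mul_edgeTest (s : ℝ) (x : E 2) :
    stepProduct x * edgeTest s x
      = (Set.Ioc 0 s).indicator 1 (x 0) * (Set.Icc (0 : ℝ) 1).indicator 1 (x 1) := by
  unfold stepProduct edgeTest haar
  by_cases h1 : x 1 ∈ Set.Icc (0 : ℝ) 1
  · have h1' := h1.1
    by_cases ha : x 0 ∈ Set.Ioc 0 s
    · have hn : x 0 ∉ Set.Ico (-s) 0 := fun h => by linarith [h.2, ha.1]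
      rw [if_pos ⟨ha.1.le, h1'⟩]
      simp [h1, ha, hn]
    · by_cases hb : x 0 ∈ Set.Ico (-s) 0
      · rw [if_neg fun h => by linarith [hb.2, h.1]]
        simp [ha]
      · simp [ha, hb]
  · simp [h1]

theorem edgeTest_sq (s : ℝ) (x : E 2) :
    edgeTest s x ^ 2 = ((Set.Ioc 0 s).indicator 1 (x 0) + (Set.Ico (-s) 0).indicator 1 (x 0)) *
      (Set.Icc (0 : ℝ) 1).indicator 1 (x 1) := by
  unfold edgeTest haar
  by_cases h1 : x 1 ∈ Set.Icc (0 : ℝ) 1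
  · by_cases ha : x 0 ∈ Set.Ioc 0 s
    · have hn : x 0 ∉ Set.Ico (-s) 0 := fun h => by linarith [h.2, ha.1]
      simp [h1, ha, hn]
    · by_cases hb : x 0 ∈ Set.Ico (-s) 0 <;> simp [h1, ha, hb]
  · simp [h1]

theorem measurable_unitIndicator : Measurable ((Set.Icc (0 : ℝ) 1).indicator (1 : ℝ → ℝ)) :=
  measurable_one.indicator measurableSet_Icc

theorem measurable_unitSquare : Measurable unitSquare :=
  (measurable_unitIndicator.comp (measurable_coord 0)).mul
    (measurable_unitIndicator.comp (measurable_coord 1))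

theorem measurable_edgeTest (s : ℝ) : Measurable (edgeTest s) :=
  (((measurable_one.indicator measurableSet_Ioc).sub
    (measurable_one.indicator measurableSet_Ico)).comp (measurable_coord 0)).mul
    (measurable_unitIndicator.comp (measurable_coord 1))

theorem measurable_stepProduct : Measurable stepProduct :=
  Measurable.ite ((measurableSet_le measurable_const (measurable_coord 0)).inter
    (measurableSet_le measurable_const (measurable_coord 1))) measurable_const measurable_const

theorem stepProduct_nonneg (x : E 2) : 0 ≤ stepProduct x := by
  unfold stepProduct; split_ifs <;> norm_num

theorem stepProduct_le_one (x : E 2) : stepProduct x ≤ 1 := by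
  unfold stepProduct; split_ifs <;> norm_num

theorem integral_stepProduct_mul_edgeTest {s : ℝ} (hs : 0 ≤ s) :
    ∫ x, stepProduct x * edgeTest s x = s := by
  simp only [stepProduct_mul_edgeTest]
  rw [integral_coord_mul ((Set.Ioc 0 s).indicator 1) ((Set.Icc (0 : ℝ) 1).indicator 1),
    integral_indicator_one measurableSet_Ioc, integral_indicator_one measurableSet_Icc]
  simp [hs]

theorem integral_edgeTest_sq {s : ℝ} (hs : 0 ≤ s) : ∫ x, edgeTest s x ^ 2 = 2 * s := by
  simp only [edgeTest_sq]
  rw [integral_coord_mul (fun t => (Set.Ioc 0 s).indicator (1 : ℝ → ℝ) t +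
      (Set.Ico (-s) 0).indicator 1 t) ((Set.Icc (0 : ℝ) 1).indicator 1),
    integral_add, integral_indicator_one measurableSet_Ioc,
    integral_indicator_one measurableSet_Ico, integral_indicator_one measurableSet_Icc]
  · simp [hs]
    ring
  · exact (integrable_indicator_iff measurableSet_Ioc).2 (integrableOn_const measure_Ioc_lt_top.ne)
  · exact (integrable_indicator_iff measurableSet_Ico).2 (integrableOn_const measure_Ico_lt_top.ne)

theorem abs_edgeTest_le (s : ℝ) (x : E 2) : |edgeTest s x| ≤ 1 := by
  rw [← sq_le_one_iff_abs_le_one, edgeTest_sq]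
  by_cases ha : x 0 ∈ Set.Ioc 0 s
  · have hn : x 0 ∉ Set.Ico (-s) 0 := fun h => by linarith [h.2, ha.1]
    by_cases h1 : x 1 ∈ Set.Icc (0 : ℝ) 1 <;> simp [h1, ha, hn]
  · by_cases hb : x 0 ∈ Set.Ico (-s) 0 <;>
      by_cases h1 : x 1 ∈ Set.Icc (0 : ℝ) 1 <;> simp [h1, ha, hb]

/-- Duality against φ = `edgeTest s`: the smoothed function G recovers at most half of the pairing
a·s of a·f with φ, so G - a·f has a component along φ that cannot be small, since ∫ φ² is only 2s.
-/
theorem le_setIntegral_bias {m : E 2 → ℝ} (hm0 : ∀ ξ, 0 ≤ m ξ) (hm : Integrable m)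
    {s M b a : ℝ} (hs0 : 0 < s) (hs1 : s ≤ 1) (ha : 0 < a) (hb : 0 < b)
    (hM : ∫ ξ : E 2, m ξ * (1 + ξ 1 ^ 2)⁻¹ ≤ M) (hsM : b * (s * M) ≤ 1 / 2) :
    a ^ 2 * s / 8 ≤ ∫ x in cube 2,
      ((b * ∫ y, a * unitSquare y * fourierKernel m (x - y)) - a * stepProduct x) ^ 2 := by
  have hKc := continuous_fourierKernel hm0 hm
  obtain ⟨A, hA⟩ : ∃ A, ∀ z, |fourierKernel m z| ≤ A := ⟨_, abs_fourierKernel_le hm0 hm⟩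
  set G : E 2 → ℝ := fun x => b * ∫ y, a * unitSquare y * fourierKernel m (x - y) with hG
  have hGm : Measurable G := by
    refine Measurable.const_mul ?_ b
    refine (StronglyMeasurable.integral_prod_right'
      (f := fun p : E 2 × E 2 => a * unitSquare p.2 * fourierKernel m (p.1 - p.2)) ?_).measurable
    exact (((measurable_unitSquare.comp measurable_snd).const_mul a).mul
      (hKc.measurable.comp (measurable_fst.sub measurable_snd))).stronglyMeasurable
  have hui : Integrable fun y => a * ‖unitSquare y‖ * A :=
    (integrable_unitSquare.norm.const_mul a).mul_const A
  obtain ⟨BG, hBG⟩ : ∃ BG, ∀ x, |G x| ≤ BG := by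
    refine ⟨b * ∫ y, a * ‖unitSquare y‖ * A, fun x => ?_⟩
    rw [hG, abs_mul, abs_of_pos hb]
    refine mul_le_mul_of_nonneg_left ?_ hb.le
    rw [← Real.norm_eq_abs]
    refine norm_integral_le_of_norm_le hui (Filter.Eventually.of_forall fun y => ?_)
    rw [norm_mul, norm_mul, Real.norm_of_nonneg ha.le]
    exact mul_le_mul_of_nonneg_left (hA _) (by positivity)
  have hφi := integrable_edgeTest s
  have hGφ : Integrable fun x => G x * edgeTest s x :=
    hφi.bdd_mul (c := BG) hGm.aestronglyMeasurable (Filter.Eventually.of_forall hBG)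
  have hfφ : Integrable fun x => stepProduct x * edgeTest s x :=
    hφi.bdd_mul (c := 1) measurable_stepProduct.aestronglyMeasurable
      (Filter.Eventually.of_forall fun x => by
        rw [Real.norm_of_nonneg (stepProduct_nonneg x)]; exact stepProduct_le_one x)
  have hφ2 : Integrable fun x => edgeTest s x ^ 2 := by
    simp only [sq]
    exact hφi.bdd_mul (c := 1) (measurable_edgeTest s).aestronglyMeasurable
      (Filter.Eventually.of_forall (abs_edgeTest_le s))
  have hT : |∫ x, G x * edgeTest s x| ≤ a * s / 2 := by
    have hpi : Integrable (fun p : E 2 × E 2 =>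
        edgeTest s p.1 * unitSquare p.2 * fourierKernel m (p.1 - p.2))
        ((volume : Measure (E 2)).prod volume) :=
      (hφi.mul_prod integrable_unitSquare).mul_bdd (c := A)
        (hKc.comp (continuous_fst.sub continuous_snd)).aestronglyMeasurable
        (Filter.Eventually.of_forall fun p => hA _)
    have h1 : ∫ x, G x * edgeTest s x = b * a *
        ∫ p : E 2 × E 2, edgeTest s p.1 * unitSquare p.2 * fourierKernel m (p.1 - p.2) := by
      rw [Measure.volume_eq_prod, integral_prod _ hpi, ← integral_const_mul]
      refine integral_congr_ae (Filter.Eventually.of_forall fun x => ?_)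
      simp only [hG, mul_assoc, integral_const_mul]
      ring
    rw [h1, abs_mul, abs_of_pos (mul_pos hb ha)]
    calc _ ≤ b * a * (s ^ 2 * M) := mul_le_mul_of_nonneg_left
          (abs_integral_edgeTest_kernel_le hm0 hm hs0.le hM) (mul_pos hb ha).le
      _ = a * s * (b * (s * M)) := by ring
      _ ≤ a * s * (1 / 2) := by gcongr
      _ = a * s / 2 := by ring
  -- Pointwise (G - af)² ≥ 2λ(af - G)φ - λ²φ². The integral of the right side is at least λas -
  -- 2λ²s, which is largest at λ = a/4 and equals a²s/8 there.
  set R : E 2 → ℝ := fun x => 2 * (a / 4) * (a * (stepProduct x * edgeTest s x) -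
    G x * edgeTest s x) - (a / 4) ^ 2 * edgeTest s x ^ 2 with hR
  have hdiff : Integrable fun x => a * (stepProduct x * edgeTest s x) - G x * edgeTest s x :=
    (hfφ.const_mul a).sub hGφ
  have hRi : Integrable R := (hdiff.const_mul _).sub (hφ2.const_mul _)
  have hRint : ∫ x, R x = 2 * (a / 4) * (a * s - ∫ x, G x * edgeTest s x)
      - (a / 4) ^ 2 * (2 * s) := by
    rw [hR, integral_sub (hdiff.const_mul _) (hφ2.const_mul _),
      integral_const_mul, integral_const_mul, integral_sub (hfφ.const_mul a) hGφ,
      integral_const_mul, integral_stepProduct_mul_edgeTest hs0.le, integral_edgeTest_sq hs0.le]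
  -- The test function vanishes off the cube because s ≤ 1, so whole-plane Fourier computations
  -- apply to the design domain.
  have hRcube : ∫ x in cube 2, R x = ∫ x, R x :=
    setIntegral_eq_integral_of_forall_compl_eq_zero fun x hx => by
      simp [hR, edgeTest_eq_zero hs1 hx]
  have hsq : IntegrableOn (fun x => (G x - a * stepProduct x) ^ 2) (cube 2) := by
    refine Measure.integrableOn_of_bounded (by rw [volume_cube_two]; norm_num)
      ((hGm.sub (measurable_stepProduct.const_mul a)).pow_const 2).aestronglyMeasurable
      (M := (BG + a) ^ 2) (Filter.Eventually.of_forall fun x => ?_)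
    rw [Real.norm_eq_abs, abs_pow]
    refine pow_le_pow_left₀ (abs_nonneg _) ((abs_sub _ _).trans (add_le_add (hBG x) ?_)) 2
    rw [abs_of_nonneg (mul_nonneg ha.le (stepProduct_nonneg x))]
    exact mul_le_of_le_one_right ha.le (stepProduct_le_one x)
  calc a ^ 2 * s / 8 ≤ ∫ x in cube 2, R x := by
        rw [hRcube, hRint]
        have := (abs_le.1 hT).2
        nlinarith
    _ ≤ _ := by
        refine integral_mono hRi.integrableOn hsq fun x => ?_
        simp only [hR]
        nlinarith [sq_nonneg (G x - a * stepProduct x + a / 4 * edgeTest s x)]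

namespace CurveletSystem

variable {W : CurveletSystem}

theorem Admissible.exists_bias_le_risk (hW : W.Admissible) {κ a : ℝ} (hκ : 0 < κ) (ha : 0 < a) :
    ∃ c : ℝ, 0 < c ∧ ∀ σ : ℝ, ∀ j₀ τ n : ℕ, 1 ≤ n →
        ENNReal.ofReal (c / 4 ^ τ) ≤ W.risk κ j₀ τ σ n fun x => a * stepProduct x := by
  obtain ⟨B, hB, hle⟩ := hW.exists_integral_multiplier_le
  -- Width s = ρ/4^τ makes (κ/4)·s·B·4^τ at most 1/4, as κBρ ≤ 1; the factor 1/4 in κ/4 is the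
  -- density of the design.
  set ρ : ℝ := 1 / (κ * B + 1) with hρ
  have hρ0 : 0 < ρ := by positivity
  have hρ1 : ρ ≤ 1 := by rw [hρ, div_le_one (by positivity)]; nlinarith [mul_pos hκ hB]
  have hρB : κ * B * ρ ≤ 1 := by
    rw [hρ, mul_one_div, div_le_one (by positivity)]
    linarith
  refine ⟨a ^ 2 * ρ / 32, by positivity, fun σ j₀ τ n hn => ?_⟩
  have h4 : (1 : ℝ) ≤ 4 ^ τ := one_le_pow₀ (by norm_num)
  have h4' : (0 : ℝ) < 4 ^ τ := by linarith
  have hfm : Measurable fun x => a * stepProduct x := measurable_stepProduct.const_mul a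
  have hfB : ∀ x, |a * stepProduct x| ≤ a := fun x => by
    rw [abs_of_nonneg (mul_nonneg ha.le (stepProduct_nonneg x))]
    exact mul_le_of_le_one_right ha.le (stepProduct_le_one x)
  refine le_trans ?_ (hW.bias_le_risk κ σ j₀ τ hn hfm hfB)
  set K := fourierKernel (W.multiplier j₀ τ)
  have hmean : ∀ x, κ * ∫ y, a * stepProduct y * K (x - y) ∂designLaw
      = κ / 4 * ∫ y, a * unitSquare y * K (x - y) := by
    intro x
    rw [integral_designLaw, ← integral_indicator measurableSet_cube_two, ← mul_assoc,
      mul_one_div]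
    congr 1
    refine integral_congr_ae (Filter.Eventually.of_forall fun y => ?_)
    simp only [← indicator_cube_stepProduct]
    by_cases hy : y ∈ cube 2 <;> simp [hy]
  simp only [hmean]
  have hbias := le_setIntegral_bias (multiplier_nonneg j₀ τ) (hW.integrable_multiplier j₀ τ)
    (s := ρ / 4 ^ τ) (b := κ / 4) (by positivity) ((div_le_one h4').2 (hρ1.trans h4)) ha
    (by positivity) (hle j₀ τ) (by
      rw [show κ / 4 * (ρ / 4 ^ τ * (B * 4 ^ τ)) = κ * B * ρ / 4 by field_simp]
      linarith)
  have h2 : a ^ 2 * ρ / 32 / 4 ^ τ ≤ ∫ x,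
      ((κ / 4 * ∫ y, a * unitSquare y * K (x - y)) - a * stepProduct x) ^ 2 ∂designLaw := by
    rw [integral_designLaw]
    refine le_trans (le_of_eq ?_) (mul_le_mul_of_nonneg_left hbias (by norm_num))
    field_simp
    norm_num
  refine (ENNReal.ofReal_le_ofReal h2).trans ?_
  by_cases hI : Integrable (fun x =>
      ((κ / 4 * ∫ y, a * unitSquare y * K (x - y)) - a * stepProduct x) ^ 2) designLaw
  · rw [ofReal_integral_eq_lintegral_ofReal hI (Filter.Eventually.of_forall fun _ => sq_nonneg _)]
  -- If the square were not integrable, its Bochner integral would be 0 by default and the bound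
  -- trivial; integrability need not be proved here.
  · rw [integral_undef hI]
    simp

end CurveletSystem

/-! ### The step product belongs to the class -/

theorem isHolder_const (d : ℕ) (β c : ℝ) : IsHolder d β fun _ => c := by
  classical
  refine ⟨fun a _ => if a = 0 then c else 0, fun x _ => by simp, fun a _ i x _ => ?_, |c|, ?_, ?_⟩
  · have : a + Pi.single i 1 ≠ 0 := fun h => by
      have := congrFun h i
      simp at this
    beta_reduce
    rw [if_neg this]
    exact hasDerivWithinAt_const _ _ _
  · intro a _ x _
    beta_reduce
    split_ifs <;> simp
  · intro a _ x _ y _ _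
    beta_reduce
    rw [sub_self, abs_zero]
    exact mul_nonneg (abs_nonneg _) (Real.rpow_nonneg (norm_nonneg _) _)

theorem const_mem_holderBall (d : ℕ) (β : ℝ) {c F : ℝ} (hc : |c| ≤ F) :
    (fun _ => c) ∈ holderBall d β F :=
  ⟨isHolder_const d β c, fun _ _ => hc⟩

/-- Labels the M classes of a partition of the sign vectors. Class 0 must hold the all-plus vector
alone, and every other class must be nonempty: the vector whose only minus sign is at m ≠ 0 has no
choice but label m. -/
theorem exists_surjective_boolVector_fin {M : ℕ} (hM : 2 ≤ M) :
    ∃ c : (Fin M → Bool) → Fin M, Function.Surjective c ∧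
      ∀ t, c t = ⟨0, by omega⟩ ↔ ∀ j, t j = true := by
  classical
  set z : Fin M := ⟨0, by omega⟩ with hz
  set o : Fin M := ⟨1, by omega⟩ with ho
  have hzo : o ≠ z := by simp [hz, ho]
  refine ⟨fun t => if ∀ j, t j = true then z else
    if h : ∃ j, j ≠ z ∧ t j = false then h.choose else o, fun m => ?_, fun t => ?_⟩
  · by_cases hm : m = z
    · exact ⟨fun _ => true, by simp [hm]⟩
    · refine ⟨fun j => decide (j ≠ m), ?_⟩
      have h1 : ¬ ∀ j, decide (j ≠ m) = true := fun h => by simpa using h m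
      have h2 : ∃ j, j ≠ z ∧ decide (j ≠ m) = false := ⟨m, hm, by simp⟩
      simp only [if_neg h1, dif_pos h2]
      simpa using h2.choose_spec.2
  · constructor
    · intro h
      by_contra hall
      simp only [if_neg hall] at h
      split_ifs at h with h2
      · exact h2.choose_spec.1 h
      · exact hzo h
    · intro h
      simp [h]

/-- Both axes are used as zero curves, the second one repeated so that there are M curves and enough
sign vectors for M classes. Pieces overlap on the axes, but all pieces except the all-plus one carry
the function 0. -/
theorem mul_stepProduct_mem_piecewiseSmooth (α β : ℝ) {F a : ℝ} (hF : 0 ≤ F) (ha : |a| ≤ F)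
    {M : ℕ} (hM : 2 ≤ M) : (fun x => a * stepProduct x) ∈ piecewiseSmooth α β F M := by
  classical
  obtain ⟨c, hc, hc0⟩ := exists_surjective_boolVector_fin hM
  set z : Fin M := ⟨0, by omega⟩ with hz
  refine ⟨M, fun j => if j = z then 0 else 1, fun _ _ => 0, fun m => {t | c t = m},
    fun m _ => if m = z then a else 0, fun _ => const_mem_holderBall _ _ (by simpa using hF),
    fun m => hc m, fun t => ⟨c t, rfl, fun m hm => hm.symm⟩, fun m => ?_, fun x hx => ?_⟩
  · refine const_mem_holderBall _ _ ?_
    split_ifs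
    · exact ha
    · simpa using hF
  · rw [Finset.sum_eq_single z]
    · have hmem : x ∈ piece (fun j => if j = z then 0 else 1) (fun _ _ => 0) {t | c t = z}
          ↔ 0 ≤ x 0 ∧ 0 ≤ x 1 := by
        constructor
        · rintro ⟨_, t, ht, hs⟩
          have ht' := (hc0 t).1 ht
          have h0 := (hs z).2
          have h1 := (hs ⟨1, by omega⟩).2
          rw [ht'] at h0 h1
          exact ⟨by simpa using h0, by simpa [hz] using h1⟩
        · rintro ⟨h0, h1⟩
          refine ⟨hx, fun _ => true, (hc0 _).2 fun _ => rfl, fun j => ⟨hx, ?_⟩⟩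
          by_cases hj : j = z
          · simpa [hj] using h0
          · simpa [hj] using h1
      unfold stepProduct
      beta_reduce
      by_cases h : 0 ≤ x 0 ∧ 0 ≤ x 1
      · rw [Set.indicator_of_mem (hmem.2 h), if_pos h, if_pos rfl, mul_one]
      · rw [Set.indicator_of_notMem fun h' => h (hmem.1 h'), if_neg h, mul_zero]
    · intro m _ hm
      simp [hm]
    · intro h
      exact absurd (Finset.mem_univ z) h

/-! ### Balancing bias and noise -/

/-- The decreasing 1/t and the increasing t²/n cross at t = n^{1/3}, where both equal n^{-1/3}. -/
theorem rate_le_max {c₁ c₂ t : ℝ} (hc₁ : 0 < c₁) (hc₂ : 0 < c₂) (ht : 0 < t) {n : ℕ} (hn : 1 ≤ n) :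
    min c₁ c₂ * (n : ℝ) ^ (-(1 / 3) : ℝ) ≤ c₁ / t ∨
      min c₁ c₂ * (n : ℝ) ^ (-(1 / 3) : ℝ) ≤ c₂ * t ^ 2 / n := by
  have hn0 : (0 : ℝ) < n := by positivity
  set q : ℝ := (n : ℝ) ^ (1 / 3 : ℝ) with hq
  have hq0 : 0 < q := Real.rpow_pos_of_pos hn0 _
  have hq3 : q ^ 3 = n := by
    rw [hq, ← Real.rpow_natCast, ← Real.rpow_mul hn0.le]
    norm_num
  rw [Real.rpow_neg hn0.le, ← hq]
  rcases le_total t q with h | h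
  · left
    rw [div_eq_mul_inv]
    exact mul_le_mul (min_le_left _ _) (inv_anti₀ ht h) (by positivity) hc₁.le
  · right
    rw [mul_div_assoc]
    refine mul_le_mul (min_le_right _ _) ?_ (by positivity) hc₂.le
    rw [← hq3, le_div_iff₀ (by positivity)]
    calc q⁻¹ * q ^ 3 = q ^ 2 := by field_simp
      _ ≤ t ^ 2 := by gcongr

namespace CurveletSystem

variable {W : CurveletSystem}

theorem Admissible.exists_rate_le_risk (hW : W.Admissible) {κ σ a : ℝ} (hκ : 0 < κ) (hσ : 0 < σ)
    (ha : 0 < a) {j₀ : ℕ} (hj₀ : j₀ ≤ 1) :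
    ∃ c : ℝ, 0 < c ∧ ∀ n : ℕ, 1 ≤ n → ∀ τ : ℕ,
      ENNReal.ofReal (c * (n : ℝ) ^ (-(1 / 3) : ℝ)) ≤
        W.risk κ j₀ τ σ n fun x => a * stepProduct x := by
  obtain ⟨c₁, hc₁, h₁⟩ := hW.exists_bias_le_risk hκ ha
  obtain ⟨c₂, hc₂, h₂⟩ := hW.exists_noise_le_risk hκ hσ
  refine ⟨min c₁ c₂, lt_min hc₁ hc₂, fun n hn τ => ?_⟩
  -- At τ = 0 the noise bound is not available (the sum may be empty or contain only the coarsest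
  -- window), but the bias bound is then a constant.
  rcases Nat.eq_zero_or_pos τ with rfl | hτ
  · refine le_trans (ENNReal.ofReal_le_ofReal ?_) (h₁ σ j₀ 0 n hn)
    rw [pow_zero, div_one]
    refine (mul_le_of_le_one_right (lt_min hc₁ hc₂).le ?_).trans (min_le_left _ _)
    exact Real.rpow_le_one_of_one_le_of_nonpos (by exact_mod_cast hn) (by norm_num)
  · rcases rate_le_max hc₁ hc₂ (show (0 : ℝ) < 4 ^ τ by positivity) hn with h | h
    · exact (ENNReal.ofReal_le_ofReal h).trans (h₁ σ j₀ τ n hn)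
    · refine (ENNReal.ofReal_le_ofReal h).trans ?_
      have h16 : ((4 : ℝ) ^ τ) ^ 2 = 16 ^ τ := by rw [← pow_mul, mul_comm, pow_mul]; norm_num
      rw [h16]
      refine h₂ j₀ hj₀ τ hτ n hn _ (measurable_stepProduct.const_mul a) a fun x => ?_
      rw [abs_of_nonneg (mul_nonneg ha.le (stepProduct_nonneg x))]
      exact mul_le_of_le_one_right ha.le (stepProduct_le_one x)

end CurveletSystem

end

/-- For every truncation level `τ` (in particular the one that minimizes the risk) the worst-case
risk over the piecewise smooth class is at least `c n^{-1/3}`, and the product of two step functions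
is a witness. `κ = 1` is the plain empirical coefficient, `κ = 4` makes it unbiased for the Lebesgue
inner product; `j₀ = 1` and `j₀ = 0` leave out and keep the coarsest scale. -/
theorem proposition5 (α β : ℝ) (hα : 2 ≤ α) (hβ : 2 ≤ β) (M : ℕ) (hM : 2 ≤ M)
    (F : ℝ) (hF : 0 < F) (σ : ℝ) (hσ : 0 < σ)
    (W : CurveletSystem) (hW : W.Admissible) (κ : ℝ) (hκ : 0 < κ) (j₀ : ℕ) (hj₀ : j₀ ≤ 1) :
    ∃ c : ℝ, 0 < c ∧
      (∀ n : ℕ, 1 ≤ n → ∀ τ : ℕ,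
        ENNReal.ofReal (c * (n : ℝ) ^ (-(1 / 3) : ℝ)) ≤
          ⨆ f ∈ piecewiseSmooth α β F M, W.risk κ j₀ τ σ n f) ∧
      (∀ n : ℕ, 1 ≤ n → ∀ τ : ℕ,
        ENNReal.ofReal (c * (n : ℝ) ^ (-(1 / 3) : ℝ)) ≤ W.risk κ j₀ τ σ n stepProduct) ∧
      (1 ≤ F → stepProduct ∈ piecewiseSmooth α β F M) := by
  -- For F < 1 the step product itself is too large for the class; the supremum is witnessed by its
  -- multiple of height min(F, 1).
  have hmin : 0 < min F 1 := lt_min hF one_pos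
  obtain ⟨c₁, hc₁, h₁⟩ := hW.exists_rate_le_risk hκ hσ hmin hj₀
  obtain ⟨c₂, hc₂, h₂⟩ := hW.exists_rate_le_risk hκ hσ one_pos hj₀
  have hmono : ∀ {c : ℝ} (n : ℕ), min c₁ c₂ ≤ c →
      ENNReal.ofReal (min c₁ c₂ * (n : ℝ) ^ (-(1 / 3) : ℝ)) ≤
        ENNReal.ofReal (c * (n : ℝ) ^ (-(1 / 3) : ℝ)) := fun n h =>
    ENNReal.ofReal_le_ofReal
      (mul_le_mul_of_nonneg_right h (Real.rpow_nonneg (Nat.cast_nonneg n) _))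
  refine ⟨min c₁ c₂, lt_min hc₁ hc₂, fun n hn τ => ?_, fun n hn τ => ?_, fun hF1 => ?_⟩
  · refine ((hmono n (min_le_left _ _)).trans (h₁ n hn τ)).trans
      (le_iSup₂_of_le (fun x => min F 1 * stepProduct x) ?_ le_rfl)
    exact mul_stepProduct_mem_piecewiseSmooth α β hF.le
      (by rw [abs_of_pos hmin]; exact min_le_left _ _) hM
  · have := h₂ n hn τ
    simp only [one_mul] at this
    exact (hmono n (min_le_right _ _)).trans this
  · have := mul_stepProduct_mem_piecewiseSmooth α β (a := 1) hF.le (by simpa using hF1) hM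
    simpa only [one_mul] using this
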